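/- Let $n, s \ge 0$ be integers and let $a_1,\dots,a_s$ be distinct points of the complex projective line $\mathbb{CP}^1$ with homogeneous coordinates $(u:v)$. For a pair $(X,Y)$ of a complex variety $X$ and a closed subvariety $Y\subset X$, its $n$-th symmetric product $S^n(X,Y)$ is the pair consisting of the quotient variety $S^nX = X^n/S_n$ and the subset of those unordered $n$-tuples of points of $X$ at least one of whose members belongs to $Y$. For a point $a=(\alpha:\beta)\in\mathbb{CP}^1$ put $$H_a=\Bigl\{(p_0:p_1:\dots:p_n)\in\mathbb{CP}^n \;:\; \sum_{j=0}^n p_j\,\alpha^j\beta^{\,n-j}=0\Bigr\};$$ thus, if $a=(x:1)$, then $H_a$ is given by $p_0+p_1x+\dots+p_nx^n=0$. Then there is an isomorphism of pairs of varieties $$S^n\bigl(\mathbb{CP}^1,\{a_1,\dots,a_s\}\bigr)\;\cong\;\bigl(\mathbb{CP}^n,\,Y\bigr),\qquad Y=H_{a_1}\cup\dots\cup H_{a_s},$$ which sends the unordered $n$-tuple of the points $(u_i:v_i)$, $1\le i\le n$, to $(p_0:\dots:p_n)$ with $$p_j=(-1)^j\sum_{\substack{S\subset\{1,\dots,n\}\\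 |S|=j}}\ \prod_{i\in S}v_i\prod_{i\notin S}u_i ,$$ and $H_{a_1},\dots,H_{a_s}$ are hyperplanes in general position: for every $k\le n+1$, the linear equations of any $k$ of them cut out a linear subspace of codimension $k$ in $\mathbb C^{n+1}$. -/

import Mathlib

open scoped LinearAlgebra.Projectivization Topology

/-- A space with functions over `ℂ` : a topological space with a sheaf of `ℂ`-valued functions,
called regular, closed under the operations of a `ℂ`-algebra and under inverting a function where
it does not vanish. The sheaf is recorded through its germs: `RegularAt f x` says that `f` is
regular on some neighbourhood of `x`, and the sections over an open set `U` are the functions that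
are regular at every point of `U` (the values of `f` outside of `U` are irrelevant by `congr`).
Complex varieties are treated as spaces with functions (on their sets of closed points). -/
structure SpaceWithFunctions where
  carrier : Type
  topology : TopologicalSpace carrier
  RegularAt : (carrier → ℂ) → carrier → Prop
  congr : ∀ {f g : carrier → ℂ} {x : carrier},
    (∀ᶠ y in 𝓝 x, f y = g y) → RegularAt f x → RegularAt g x
  eventually : ∀ {f : carrier → ℂ} {x : carrier}, RegularAt f x → ∀ᶠ y in 𝓝 x, RegularAt f y
  const : ∀ (c : ℂ) (x : carrier), RegularAt (fun _ => c) x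
  add : ∀ {f g : carrier → ℂ} {x : carrier},
    RegularAt f x → RegularAt g x → RegularAt (fun y => f y + g y) x
  mul : ∀ {f g : carrier → ℂ} {x : carrier},
    RegularAt f x → RegularAt g x → RegularAt (fun y => f y * g y) x
  ne_zero : ∀ {f : carrier → ℂ} {x : carrier}, RegularAt f x → f x ≠ 0 → ∀ᶠ y in 𝓝 x, f y ≠ 0
  inv : ∀ {f : carrier → ℂ} {x : carrier},
    RegularAt f x → f x ≠ 0 → RegularAt (fun y => (f y)⁻¹) x

namespace SpaceWithFunctions

instance : CoeSort SpaceWithFunctions Type := ⟨carrier⟩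

attribute [instance] SpaceWithFunctions.topology

/-- An isomorphism of spaces with functions: a homeomorphism under which the regular functions
correspond to each other. -/
structure Iso (X Y : SpaceWithFunctions) extends X ≃ₜ Y where
  regularAt_iff : ∀ (g : Y → ℂ) (x : X),
    Y.RegularAt g (toHomeomorph x) ↔ X.RegularAt (fun y => g (toHomeomorph y)) x

/-! ### Quotients -/

/-- The quotient of a space with functions by an equivalence relation: the quotient topology, and
a function on an open subset of the quotient is regular if its pullback is. -/
def quotient (X : SpaceWithFunctions) (r : Setoid X) : SpaceWithFunctions where
  carrier := Quotient r
  topology := inferInstance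
  RegularAt f q := ∀ᶠ p in 𝓝 q, ∀ x : X, Quotient.mk r x = p →
    X.RegularAt (fun y => f (Quotient.mk r y)) x
  congr := by
    intro f g q h hf
    filter_upwards [hf, eventually_eventually_nhds.2 h] with p hp hp' x hx
    subst hx
    exact X.congr (continuous_quotient_mk'.continuousAt.eventually hp') (hp x rfl)
  eventually := fun h => eventually_eventually_nhds.2 h
  const := fun c q => Filter.Eventually.of_forall fun _ x _ => X.const c x
  add := by
    intro f g q hf hg
    filter_upwards [hf, hg] with p h1 h2 x hx
    exact X.add (h1 x hx) (h2 x hx)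
  mul := by
    intro f g q hf hg
    filter_upwards [hf, hg] with p h1 h2 x hx
    exact X.mul (h1 x hx) (h2 x hx)
  ne_zero := by
    intro f q hf h0
    obtain ⟨V, hV, hVo, hq⟩ := eventually_nhds_iff.1 hf
    refine eventually_nhds_iff.2 ⟨{p | p ∈ V ∧ f p ≠ 0}, fun p hp => hp.2, ?_, hq, h0⟩
    refine isQuotientMap_quotient_mk'.isOpen_preimage.1 (isOpen_iff_eventually.2 ?_)
    rintro x ⟨hx1, hx2⟩
    filter_upwards [continuous_quotient_mk'.continuousAt.eventually (hVo.eventually_mem hx1),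
      X.ne_zero (hV _ hx1 x rfl) hx2] with y h1 h2
    exact ⟨h1, h2⟩
  inv := by
    intro f q hf h0
    have hne : ∀ᶠ p in 𝓝 q, f p ≠ 0 := by
      obtain ⟨V, hV, hVo, hq⟩ := eventually_nhds_iff.1 hf
      refine eventually_nhds_iff.2 ⟨{p | p ∈ V ∧ f p ≠ 0}, fun p hp => hp.2, ?_, hq, h0⟩
      refine isQuotientMap_quotient_mk'.isOpen_preimage.1 (isOpen_iff_eventually.2 ?_)
      rintro x ⟨hx1, hx2⟩
      filter_upwards [continuous_quotient_mk'.continuousAt.eventually (hVo.eventually_mem hx1),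
        X.ne_zero (hV _ hx1 x rfl) hx2] with y h1 h2
      exact ⟨h1, h2⟩
    filter_upwards [hf, hne] with p h1 h2 x hx
    subst hx
    exact X.inv (h1 x rfl) h2

/-! ### Cartesian powers -/

/-- On the box `U 0 × ⋯ × U (n - 1)`, the function `h` belongs to the tensor product of the
algebras of regular functions on the `U i` : it is a finite sum of multiples of products
`f 0 (x 0) * ⋯ * f (n - 1) (x (n - 1))` with `f i` regular on `U i`. -/
def IsTensor (X : SpaceWithFunctions) (n : ℕ) (U : Fin n → Set X) (h : (Fin n → X) → ℂ) : Prop :=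
  ∃ (m : ℕ) (c : Fin m → ℂ) (f : Fin m → Fin n → X → ℂ),
    (∀ k i, ∀ y ∈ U i, X.RegularAt (f k i) y) ∧
      ∀ x : Fin n → X, (∀ i, x i ∈ U i) → h x = ∑ k, c k * ∏ i, f k i (x i)

/-- The topology of the `n`-th Cartesian power of `X` in the category of spaces with functions
(in general finer than the product topology): a basis is given by the sets of points of boxes at
which a tensor does not vanish. -/
@[reducible]
def powTopology (X : SpaceWithFunctions) (n : ℕ) : TopologicalSpace (Fin n → X) :=
  TopologicalSpace.generateFrom
    {W | ∃ (U : Fin n → Set X) (h : (Fin n → X) → ℂ), (∀ i, IsOpen (U i)) ∧ X.IsTensor n U h ∧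
      W = {x | (∀ i, x i ∈ U i) ∧ h x ≠ 0}}

variable {X : SpaceWithFunctions} {n : ℕ}

theorem IsTensor.mono {U V : Fin n → Set X} {h : (Fin n → X) → ℂ} (hh : X.IsTensor n U h)
    (hV : ∀ i, V i ⊆ U i) : X.IsTensor n V h := by
  obtain ⟨m, c, f, hf, he⟩ := hh
  exact ⟨m, c, f, fun k i y hy => hf k i y (hV i hy), fun x hx => he x fun i => hV i (hx i)⟩

theorem IsTensor.const (U : Fin n → Set X) (c : ℂ) : X.IsTensor n U (fun _ => c) :=
  ⟨1, fun _ => c, fun _ _ _ => 1, fun _ _ y _ => X.const 1 y, fun x _ => by simp⟩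

theorem IsTensor.add {U : Fin n → Set X} {g h : (Fin n → X) → ℂ} (hg : X.IsTensor n U g)
    (hh : X.IsTensor n U h) : X.IsTensor n U (fun x => g x + h x) := by
  obtain ⟨m, c, f, hf, he⟩ := hg
  obtain ⟨m', c', f', hf', he'⟩ := hh
  refine ⟨m + m', Fin.append c c', Fin.append f f', ?_, ?_⟩
  · intro k
    refine Fin.addCases (fun k => ?_) (fun k => ?_) k
    · simpa using hf k
    · simpa using hf' k
  · intro x hx
    simp [Fin.sum_univ_add, he x hx, he' x hx]

theorem IsTensor.mul {U : Fin n → Set X} {g h : (Fin n → X) → ℂ} (hg : X.IsTensor n U g)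
    (hh : X.IsTensor n U h) : X.IsTensor n U (fun x => g x * h x) := by
  obtain ⟨m, c, f, hf, he⟩ := hg
  obtain ⟨m', c', f', hf', he'⟩ := hh
  refine ⟨m * m', fun k => c (finProdFinEquiv.symm k).1 * c' (finProdFinEquiv.symm k).2,
    fun k i y => f (finProdFinEquiv.symm k).1 i y * f' (finProdFinEquiv.symm k).2 i y,
    fun k i y hy => X.mul (hf _ i y hy) (hf' _ i y hy), ?_⟩
  intro x hx
  show g x * h x = _
  rw [he x hx, he' x hx, Finset.sum_mul_sum, ← Finset.sum_product', Finset.univ_product_univ,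
    ← finProdFinEquiv.symm.sum_comp]
  refine Finset.sum_congr rfl fun k _ => ?_
  rw [Finset.prod_mul_distrib]
  ring

theorem eventually_ne_zero_of_isTensor {U : Fin n → Set X} {h : (Fin n → X) → ℂ} {x : Fin n → X}
    (hU : ∀ i, IsOpen (U i)) (hh : X.IsTensor n U h) (hx : ∀ i, x i ∈ U i) (h0 : h x ≠ 0) :
    ∀ᶠ y in @nhds _ (X.powTopology n) x, (∀ i, y i ∈ U i) ∧ h y ≠ 0 := by
  let _ := X.powTopology n
  have : IsOpen {y : Fin n → X | (∀ i, y i ∈ U i) ∧ h y ≠ 0} :=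
    TopologicalSpace.isOpen_generateFrom_of_mem ⟨U, h, hU, hh, rfl⟩
  exact this.eventually_mem (show x ∈ {y : Fin n → X | _} from ⟨hx, h0⟩)

theorem continuous_proj (i : Fin n) :
    @Continuous _ _ (X.powTopology n) _ (fun x : Fin n → X => x i) := by
  let _ := X.powTopology n
  refine continuous_def.2 fun s hs => isOpen_iff_eventually.2 fun x hx => ?_
  have := eventually_ne_zero_of_isTensor (X := X) (x := x)
    (U := fun j => if j = i then s else Set.univ) (h := fun _ => 1)
    (fun j => by split_ifs; exacts [hs, isOpen_univ]) (IsTensor.const _ 1)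
    (fun j => by
      by_cases hj : j = i
      · subst hj; simpa using hx
      · simp [hj]) one_ne_zero
  filter_upwards [this] with y hy
  simpa using hy.1 i

/-- The `n`-th Cartesian power of a space with functions (its product in the category of spaces
with functions): a function is regular if it is locally a quotient of two tensors. -/
def pow (X : SpaceWithFunctions) (n : ℕ) : SpaceWithFunctions where
  carrier := Fin n → X
  topology := X.powTopology n
  RegularAt F x := ∃ (U : Fin n → Set X) (N D : (Fin n → X) → ℂ),
    (∀ i, IsOpen (U i)) ∧ (∀ i, x i ∈ U i) ∧ X.IsTensor n U N ∧ X.IsTensor n U D ∧ D x ≠ 0 ∧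
      ∀ᶠ y in @nhds _ (X.powTopology n) x, F y = N y / D y
  congr := by
    rintro f g x h ⟨U, N, D, hU, hx, hN, hD, h0, he⟩
    refine ⟨U, N, D, hU, hx, hN, hD, h0, ?_⟩
    filter_upwards [h, he] with y h1 h2
    rw [← h1, h2]
  eventually := by
    rintro f x ⟨U, N, D, hU, hx, hN, hD, h0, he⟩
    filter_upwards [eventually_ne_zero_of_isTensor hU hD hx h0,
      (@eventually_eventually_nhds _ (X.powTopology n) _ _).2 he] with y h1 h2
    exact ⟨U, N, D, hU, h1.1, hN, hD, h1.2, h2⟩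
  const := fun c x => ⟨fun _ => Set.univ, fun _ => c, fun _ => 1, fun _ => isOpen_univ,
    fun _ => Set.mem_univ _, IsTensor.const _ _, IsTensor.const _ _, one_ne_zero,
    Filter.Eventually.of_forall fun _ => by simp⟩
  add := by
    rintro f g x ⟨U, N, D, hU, hx, hN, hD, h0, he⟩ ⟨U', N', D', hU', hx', hN', hD', h0', he'⟩
    have hN := hN.mono (V := fun i => U i ∩ U' i) fun i => Set.inter_subset_left
    have hD := hD.mono (V := fun i => U i ∩ U' i) fun i => Set.inter_subset_left
    have hN' := hN'.mono (V := fun i => U i ∩ U' i) fun i => Set.inter_subset_right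
    have hD' := hD'.mono (V := fun i => U i ∩ U' i) fun i => Set.inter_subset_right
    refine ⟨_, _, _, fun i => (hU i).inter (hU' i), fun i => ⟨hx i, hx' i⟩,
      (hN.mul hD').add (hD.mul hN'), hD.mul hD', mul_ne_zero h0 h0', ?_⟩
    filter_upwards [he, he', eventually_ne_zero_of_isTensor (fun i => (hU i).inter (hU' i)) hD
      (fun i => ⟨hx i, hx' i⟩) h0, eventually_ne_zero_of_isTensor
      (fun i => (hU i).inter (hU' i)) hD' (fun i => ⟨hx i, hx' i⟩) h0'] with y h1 h2 h3 h4
    rw [h1, h2, div_add_div _ _ h3.2 h4.2]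
  mul := by
    rintro f g x ⟨U, N, D, hU, hx, hN, hD, h0, he⟩ ⟨U', N', D', hU', hx', hN', hD', h0', he'⟩
    have hN := hN.mono (V := fun i => U i ∩ U' i) fun i => Set.inter_subset_left
    have hD := hD.mono (V := fun i => U i ∩ U' i) fun i => Set.inter_subset_left
    have hN' := hN'.mono (V := fun i => U i ∩ U' i) fun i => Set.inter_subset_right
    have hD' := hD'.mono (V := fun i => U i ∩ U' i) fun i => Set.inter_subset_right
    refine ⟨_, _, _, fun i => (hU i).inter (hU' i), fun i => ⟨hx i, hx' i⟩,
      hN.mul hN', hD.mul hD', mul_ne_zero h0 h0', ?_⟩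
    filter_upwards [he, he'] with y h1 h2
    rw [h1, h2, div_mul_div_comm]
  ne_zero := by
    rintro f x ⟨U, N, D, hU, hx, hN, hD, h0, he⟩ hf
    have hx0 : N x ≠ 0 := by
      intro h
      apply hf
      rw [@Filter.Eventually.self_of_nhds _ (X.powTopology n) _ _ he, h, zero_div]
    filter_upwards [he, eventually_ne_zero_of_isTensor hU hD hx h0,
      eventually_ne_zero_of_isTensor hU hN hx hx0] with y h1 h2 h3
    rw [h1]
    exact div_ne_zero h3.2 h2.2
  inv := by
    rintro f x ⟨U, N, D, hU, hx, hN, hD, h0, he⟩ hf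
    have hx0 : N x ≠ 0 := by
      intro h
      apply hf
      rw [@Filter.Eventually.self_of_nhds _ (X.powTopology n) _ _ he, h, zero_div]
    refine ⟨U, D, N, hU, hx, hD, hN, hx0, ?_⟩
    filter_upwards [he] with y h1
    rw [h1, inv_div]

/-- Two ordered `n`-tuples are equivalent if they differ by a permutation of the indices. -/
def permSetoid (X : SpaceWithFunctions) (n : ℕ) : Setoid (X.pow n) where
  r x y := ∃ σ : Equiv.Perm (Fin n), ∀ i, y i = x (σ i)
  iseqv :=
    { refl := fun _ => ⟨1, fun _ => rfl⟩
      symm := by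
        rintro x y ⟨σ, h⟩
        exact ⟨σ⁻¹, fun i => by rw [h]; simp⟩
      trans := by
        rintro x y z ⟨σ, h⟩ ⟨τ, h'⟩
        exact ⟨σ * τ, fun i => by rw [h', h]; rfl⟩ }

/-- The `n`-th symmetric product `X ^ n / S_n`. -/
def symPow (X : SpaceWithFunctions) (n : ℕ) : SpaceWithFunctions :=
  (X.pow n).quotient (X.permSetoid n)

/-- The unordered `n`-tuple of an ordered `n`-tuple. -/
def symPowMk (X : SpaceWithFunctions) {n : ℕ} (x : Fin n → X) : X.symPow n :=
  Quotient.mk (X.permSetoid n) x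

end SpaceWithFunctions

/-! ### Pairs -/

/-- A pair `(X, Y)` of a space with functions `X`, the ambient variety, and a closed subset `Y` of
it, the subvariety. -/
structure ClosedPair where
  ambient : SpaceWithFunctions
  sub : Set ambient
  isClosed : IsClosed sub

namespace ClosedPair

/-- An isomorphism of pairs: an isomorphism of the ambient varieties that carries one subvariety
onto the other. -/
structure Iso (P Q : ClosedPair) extends SpaceWithFunctions.Iso P.ambient Q.ambient where
  image_sub : toHomeomorph '' P.sub = Q.sub

/-- The `n`-th symmetric product of a pair `(X, Y)`: the symmetric product of `X` with the
unordered `n`-tuples of points of `X` at least one of which belongs to `Y`. -/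
def symPow (P : ClosedPair) (n : ℕ) : ClosedPair where
  ambient := P.ambient.symPow n
  sub := {q | ∃ x : Fin n → P.ambient, P.ambient.symPowMk x = q ∧ ∃ i, x i ∈ P.sub}
  isClosed := by
    refine (isQuotientMap_quotient_mk' (s := P.ambient.permSetoid n)).isClosed_preimage.1 ?_
    have : (Quotient.mk (P.ambient.permSetoid n)) ⁻¹'
        {q | ∃ x : Fin n → P.ambient, P.ambient.symPowMk x = q ∧ ∃ i, x i ∈ P.sub} =
        ⋃ i, (fun x : Fin n → P.ambient => x i) ⁻¹' P.sub := by
      ext y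
      constructor
      · rintro ⟨x, hx, i, hi⟩
        obtain ⟨σ, hσ⟩ := Quotient.exact hx
        refine Set.mem_iUnion.2 ⟨σ⁻¹ i, ?_⟩
        have h := hσ (σ⁻¹ i)
        have h' : σ (σ⁻¹ i) = i := σ.apply_symm_apply i
        have h'' : y (σ⁻¹ i) = x i := h.trans (congrArg x h')
        exact (congrArg (· ∈ P.sub) h'').mpr hi
      · intro h
        obtain ⟨i, hi⟩ := Set.mem_iUnion.1 h
        exact ⟨y, rfl, i, hi⟩
    refine Eq.mpr (congrArg _ this) ?_
    let _ := P.ambient.powTopology n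
    exact isClosed_iUnion_of_finite fun i =>
      P.isClosed.preimage (SpaceWithFunctions.continuous_proj i)

end ClosedPair

/-! ### Projective space -/

/-- The Zariski topology of `ℂℙⁿ`: a basis is given by the sets of points at which a homogeneous
polynomial does not vanish. -/
@[reducible]
def zariskiTopology (n : ℕ) : TopologicalSpace (ℙ ℂ (Fin (n + 1) → ℂ)) :=
  TopologicalSpace.generateFrom
    {W | ∃ (d : ℕ) (F : MvPolynomial (Fin (n + 1)) ℂ), F.IsHomogeneous d ∧
      W = {p | MvPolynomial.eval p.rep F ≠ 0}}

theorem eventually_eval_ne_zero {n d : ℕ} {F : MvPolynomial (Fin (n + 1)) ℂ}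
    (hF : F.IsHomogeneous d) {p : ℙ ℂ (Fin (n + 1) → ℂ)} (hp : MvPolynomial.eval p.rep F ≠ 0) :
    ∀ᶠ q in @nhds _ (zariskiTopology n) p, MvPolynomial.eval q.rep F ≠ 0 := by
  let _ := zariskiTopology n
  have : IsOpen {q : ℙ ℂ (Fin (n + 1) → ℂ) | MvPolynomial.eval q.rep F ≠ 0} :=
    TopologicalSpace.isOpen_generateFrom_of_mem ⟨d, F, hF, rfl⟩
  exact this.eventually_mem (show p ∈ {q : ℙ ℂ (Fin (n + 1) → ℂ) | _} from hp)

/-- The projective space `ℂℙⁿ` as a variety: a function is regular if it is locally a quotient of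
two homogeneous polynomials of the same degree. -/
def projectiveSpace (n : ℕ) : SpaceWithFunctions where
  carrier := ℙ ℂ (Fin (n + 1) → ℂ)
  topology := zariskiTopology n
  RegularAt f p := ∃ (d : ℕ) (F G : MvPolynomial (Fin (n + 1)) ℂ),
    F.IsHomogeneous d ∧ G.IsHomogeneous d ∧ MvPolynomial.eval p.rep G ≠ 0 ∧
      ∀ᶠ q in @nhds _ (zariskiTopology n) p,
        f q = MvPolynomial.eval q.rep F / MvPolynomial.eval q.rep G
  congr := by
    rintro f g p h ⟨d, F, G, hF, hG, h0, he⟩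
    refine ⟨d, F, G, hF, hG, h0, ?_⟩
    filter_upwards [h, he] with y h1 h2
    rw [← h1, h2]
  eventually := by
    rintro f p ⟨d, F, G, hF, hG, h0, he⟩
    filter_upwards [eventually_eval_ne_zero hG h0,
      (@eventually_eventually_nhds _ (zariskiTopology n) _ _).2 he] with q h1 h2
    exact ⟨d, F, G, hF, hG, h1, h2⟩
  const := fun c p => ⟨0, MvPolynomial.C c, MvPolynomial.C 1, MvPolynomial.isHomogeneous_C _ _,
    MvPolynomial.isHomogeneous_C _ _, by simp, Filter.Eventually.of_forall fun _ => by simp⟩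
  add := by
    rintro f g p ⟨d, F, G, hF, hG, h0, he⟩ ⟨d', F', G', hF', hG', h0', he'⟩
    refine ⟨d + d', F * G' + G * F', G * G', (hF.mul hG').add (hG.mul hF'), hG.mul hG', ?_, ?_⟩
    · simpa using ⟨h0, h0'⟩
    · filter_upwards [he, he', eventually_eval_ne_zero hG h0,
        eventually_eval_ne_zero hG' h0'] with q h1 h2 h3 h4
      rw [h1, h2, div_add_div _ _ h3 h4]
      simp
  mul := by
    rintro f g p ⟨d, F, G, hF, hG, h0, he⟩ ⟨d', F', G', hF', hG', h0', he'⟩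
    refine ⟨d + d', F * F', G * G', hF.mul hF', hG.mul hG', ?_, ?_⟩
    · simpa using ⟨h0, h0'⟩
    · filter_upwards [he, he'] with q h1 h2
      rw [h1, h2, div_mul_div_comm]
      simp
  ne_zero := by
    rintro f p ⟨d, F, G, hF, hG, h0, he⟩ hf
    have hx0 : MvPolynomial.eval p.rep F ≠ 0 := by
      intro h
      apply hf
      rw [@Filter.Eventually.self_of_nhds _ (zariskiTopology n) _ _ he, h, zero_div]
    filter_upwards [he, eventually_eval_ne_zero hG h0, eventually_eval_ne_zero hF hx0]
      with q h1 h2 h3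
    rw [h1]
    exact div_ne_zero h3 h2
  inv := by
    rintro f p ⟨d, F, G, hF, hG, h0, he⟩ hf
    have hx0 : MvPolynomial.eval p.rep F ≠ 0 := by
      intro h
      apply hf
      rw [@Filter.Eventually.self_of_nhds _ (zariskiTopology n) _ _ he, h, zero_div]
    refine ⟨d, G, F, hG, hF, hx0, ?_⟩
    filter_upwards [he] with q h1
    rw [h1, inv_div]

theorem isClosed_zeroLocus {n d : ℕ} {F : MvPolynomial (Fin (n + 1)) ℂ} (hF : F.IsHomogeneous d) :
    @IsClosed _ (zariskiTopology n) {p : ℙ ℂ (Fin (n + 1) → ℂ) | MvPolynomial.eval p.rep F = 0} := by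
  let _ := zariskiTopology n
  refine isOpen_compl_iff.1 (isOpen_iff_eventually.2 ?_)
  intro p hp
  exact eventually_eval_ne_zero hF hp

/-- The points of `ℂℙⁿ` that lie in a linear subspace of `ℂⁿ⁺¹`. -/
def projectiveLocus {n : ℕ} (W : Submodule ℂ (Fin (n + 1) → ℂ)) : Set (projectiveSpace n) :=
  {p : ℙ ℂ (Fin (n + 1) → ℂ) | p.submodule ≤ W}

/-- The linear form `p ↦ p₀ βⁿ + p₁ α βⁿ⁻¹ + ⋯ + pₙ αⁿ` attached to a point `a = (α : β)` of the
projective line. -/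
noncomputable def rootForm (n : ℕ) (a : ℙ ℂ (Fin 2 → ℂ)) : (Fin (n + 1) → ℂ) →ₗ[ℂ] ℂ :=
  ∑ j : Fin (n + 1), (a.rep 0 ^ (j : ℕ) * a.rep 1 ^ (n - (j : ℕ))) • LinearMap.proj j

/-- The linear subspace `p₀ βⁿ + p₁ α βⁿ⁻¹ + ⋯ + pₙ αⁿ = 0` attached to `a = (α : β)`. -/
noncomputable def rootHyperplane (n : ℕ) (a : ℙ ℂ (Fin 2 → ℂ)) : Submodule ℂ (Fin (n + 1) → ℂ) :=
  LinearMap.ker (rootForm n a)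

/-- A family of linear hyperplanes is in general position if the intersection of any `k` of them
has codimension `k`, for all `k` up to the dimension of the vector space. (For `k = 1` this says
that they are hyperplanes.) -/
def InGeneralPosition {ι V : Type*} [AddCommGroup V] [Module ℂ V] (W : ι → Submodule ℂ V) : Prop :=
  ∀ I : Finset ι, I.card ≤ Module.finrank ℂ V →
    Module.finrank ℂ (⨅ i ∈ I, W i : Submodule ℂ V) + I.card = Module.finrank ℂ V

theorem isClosed_projectiveLocus_rootHyperplane (n : ℕ) (a : ℙ ℂ (Fin 2 → ℂ)) :
    IsClosed (projectiveLocus (rootHyperplane n a)) := by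
  have h : (∑ j : Fin (n + 1), MvPolynomial.C (a.rep 0 ^ (j : ℕ) * a.rep 1 ^ (n - (j : ℕ))) *
      MvPolynomial.X j : MvPolynomial (Fin (n + 1)) ℂ).IsHomogeneous 1 :=
    MvPolynomial.IsHomogeneous.sum _ _ _ fun j _ =>
      (MvPolynomial.isHomogeneous_X ℂ j).C_mul _
  have h2 := isClosed_zeroLocus h
  refine Eq.mpr (congrArg _ ?_) h2
  ext (p : ℙ ℂ (Fin (n + 1) → ℂ))
  change p.submodule ≤ rootHyperplane n a ↔ MvPolynomial.eval p.rep _ = 0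
  rw [Projectivization.submodule_eq, Submodule.span_singleton_le_iff_mem]
  simp [rootHyperplane, rootForm]

theorem isClosed_singleton_projectiveLine (a : ℙ ℂ (Fin 2 → ℂ)) :
    IsClosed ({a} : Set (projectiveSpace 1)) := by
  have h : (MvPolynomial.C (a.rep 1) * MvPolynomial.X 0 - MvPolynomial.C (a.rep 0) *
      MvPolynomial.X 1 : MvPolynomial (Fin 2) ℂ).IsHomogeneous 1 :=
    ((MvPolynomial.isHomogeneous_X ℂ 0).C_mul _).sub ((MvPolynomial.isHomogeneous_X ℂ 1).C_mul _)
  have h2 := isClosed_zeroLocus h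
  refine Eq.mpr (congrArg _ ?_) h2
  ext (p : ℙ ℂ (Fin 2 → ℂ))
  change p = a ↔ MvPolynomial.eval p.rep _ = 0
  simp only [map_sub, map_mul, MvPolynomial.eval_C, MvPolynomial.eval_X]
  constructor
  · rintro rfl; ring
  · intro h
    rw [← p.mk_rep, ← a.mk_rep, Projectivization.mk_eq_mk_iff']
    by_cases h0 : a.rep 0 = 0
    · have h1 : a.rep 1 ≠ 0 := by
        intro h1
        exact a.rep_nonzero (by ext i; fin_cases i <;> simp [h0, h1])
      refine ⟨p.rep 1 / a.rep 1, ?_⟩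
      have : p.rep 0 = 0 := by simpa [h0, h1] using h
      ext i; fin_cases i <;> simp [h0, h1, this]
    · refine ⟨p.rep 0 / a.rep 0, ?_⟩
      ext i; fin_cases i
      · simp [h0]
      · simp only [Fin.mk_one, Pi.smul_apply, smul_eq_mul]
        field_simp
        linear_combination h

/-- The pair of the projective line and its points `a 0, …, a (s - 1)`. -/
def lineWithPoints {s : ℕ} (a : Fin s → ℙ ℂ (Fin 2 → ℂ)) : ClosedPair where
  ambient := projectiveSpace 1
  sub := Set.range a
  isClosed := by
    have h : IsClosed (⋃ i, ({a i} : Set (projectiveSpace 1))) :=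
      isClosed_iUnion_of_finite fun i => isClosed_singleton_projectiveLine (a i)
    refine Eq.mp (congrArg _ ?_) h
    ext p
    refine Set.mem_iUnion.trans ⟨?_, ?_⟩
    · rintro ⟨i, hi⟩
      exact ⟨i, (Set.mem_singleton_iff.1 hi).symm⟩
    · rintro ⟨i, hi⟩
      exact ⟨i, Set.mem_singleton_iff.2 hi.symm⟩

/-- The pair of `ℂℙⁿ` and the union of the hyperplanes attached to `a 0, …, a (s - 1)`. -/
noncomputable def spaceWithHyperplanes (n : ℕ) {s : ℕ} (a : Fin s → ℙ ℂ (Fin 2 → ℂ)) :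
    ClosedPair where
  ambient := projectiveSpace n
  sub := ⋃ i, projectiveLocus (rootHyperplane n (a i))
  isClosed := isClosed_iUnion_of_finite fun i => isClosed_projectiveLocus_rootHyperplane n (a i)

/-- For vectors `w i = (u i, v i)`, the coordinate `p_j` is `(-1) ^ j` times the sum, over the sets
`S` of `j` indices, of the products of the `v i` with `i` in `S` and the `u i` with `i` not in
`S`. -/
def rootCoords {n : ℕ} (w : Fin n → Fin 2 → ℂ) : Fin (n + 1) → ℂ := fun j =>
  (-1) ^ (j : ℕ) * ∑ S ∈ (Finset.univ : Finset (Fin n)).powersetCard j,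
    (∏ i ∈ S, w i 1) * ∏ i ∈ Sᶜ, w i 0

/-! The root coordinates of vectors `(u_i, v_i)` are the coefficients of the binary form `∏ (β u_i -
α v_i)` (`binaryForm_rootCoords`). So the map sends an unordered tuple to the form, up to scalars,
having exactly these zeros, and both claims about hyperplanes follow by evaluating that product.

Bijectivity is factorization of polynomials. Since `ℂ` is infinite, any finite set of points lies in
one chart `u + t v ≠ 0`. There, with `z = v / (u + t v)`, a linear substitution turns the form into
the monic polynomial `∏ (X + z_i)`. Algebraic closedness gives surjectivity
(`exists_rootCoords_affineLift_eq`), and comparing roots gives injectivity up to order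
(`exists_perm_of_prod_X_add_C_eq`).

For topology and functions, the power of a chart is the preimage of the complement of a hyperplane
(`mem_affineBox_iff`). On it, regular functions are locally fractions of polynomials in the `z_i`,
and neighbourhoods contain principal open sets (`isPolyFraction_of_regularAt_pow`,
`polyNhds_le_nhds_pow`). Summing over permutations, after multiplication by a factor that prevents
cancellation, makes numerators and denominators symmetric. Symmetric polynomials are polynomials in
the elementary ones, which are quotients of linear forms on `ℂℙⁿ`
(`exists_regularAt_eq_eval_affineCoords`). Hence the map is open and invariant regular functions
descend.

General position is interpolation: a product of linear forms vanishes at up to `n` prescribed points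
and not at another one, so evaluations at up to `n + 1` distinct points are independent. -/

/-! ### Binary forms and products of linear forms -/

theorem exists_forall_add_mul_ne_zero {ι : Type*} [Finite ι] (w : ι → Fin 2 → ℂ)
    (hw : ∀ i, w i ≠ 0) : ∃ t : ℂ, ∀ i, w i 0 + t * w i 1 ≠ 0 := by
  -- Only finitely many `t` are bad. For `w i 1 = 0` the quotient is the default `0`, excluded
  -- needlessly; there `w i 0 ≠ 0` already suffices.
  obtain ⟨t, ht⟩ := (Set.finite_range fun i => -(w i 0) / w i 1).exists_notMem
  refine ⟨t, fun i h => ?_⟩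
  by_cases h1 : w i 1 = 0
  · refine hw i (funext fun j => ?_)
    fin_cases j
    · simpa [h1] using h
    · exact h1
  · exact ht ⟨i, by field_simp; linear_combination -h⟩

/-- The binary form `∑ p_j α ^ j β ^ (n - j)` with coefficients `p`. -/
def binaryForm {n : ℕ} (p : Fin (n + 1) → ℂ) (α β : ℂ) : ℂ :=
  ∑ j : Fin (n + 1), p j * (α ^ (j : ℕ) * β ^ (n - (j : ℕ)))

theorem binaryForm_smul {n : ℕ} (c : ℂ) (p : Fin (n + 1) → ℂ) (α β : ℂ) :
    binaryForm (c • p) α β = c * binaryForm p α β := by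
  simp [binaryForm, Finset.mul_sum, mul_assoc]

theorem binaryForm_sub {n : ℕ} (p q : Fin (n + 1) → ℂ) (α β : ℂ) :
    binaryForm (p - q) α β = binaryForm p α β - binaryForm q α β := by
  simp [binaryForm, ← Finset.sum_sub_distrib, sub_mul]

theorem rootForm_apply (n : ℕ) (a : ℙ ℂ (Fin 2 → ℂ)) (p : Fin (n + 1) → ℂ) :
    rootForm n a p = binaryForm p (a.rep 0) (a.rep 1) := by
  simp [rootForm, binaryForm, mul_comm]

theorem binaryForm_mul_mul {n : ℕ} (p : Fin (n + 1) → ℂ) (c α β : ℂ) :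
    binaryForm p (c * α) (c * β) = c ^ n * binaryForm p α β := by
  rw [binaryForm, binaryForm, Finset.mul_sum]
  refine Finset.sum_congr rfl fun j _ => ?_
  have : c ^ n = c ^ (j : ℕ) * c ^ (n - (j : ℕ)) := by
    rw [← pow_add, Nat.add_sub_cancel' (Nat.lt_succ_iff.1 j.2)]
  rw [this, mul_pow, mul_pow]
  ring

/-- Expand the product: choosing `-α v_i` for `i ∈ S` and `β u_i` elsewhere contributes to the
monomial with `α`-exponent `|S|`. -/
theorem binaryForm_rootCoords {n : ℕ} (w : Fin n → Fin 2 → ℂ) (α β : ℂ) :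
    binaryForm (rootCoords w) α β = ∏ i, (β * w i 0 - α * w i 1) := by
  have h : ∀ i, β * w i 0 - α * w i 1 = -α * w i 1 + β * w i 0 := fun i => by ring
  simp_rw [h, Finset.prod_add, Finset.sum_powerset, Finset.card_univ, Fintype.card_fin]
  rw [Finset.sum_range, binaryForm]
  refine Finset.sum_congr rfl fun j _ => ?_
  rw [rootCoords, Finset.mul_sum, Finset.sum_mul]
  refine Finset.sum_congr rfl fun S hS => ?_
  have hc : S.card = j := (Finset.mem_powersetCard.1 hS).2
  have hc' : Sᶜ.card = n - j := by rw [Finset.card_compl, hc, Fintype.card_fin]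
  rw [← Finset.compl_eq_univ_sdiff, Finset.prod_mul_distrib, Finset.prod_mul_distrib,
    Finset.prod_const, Finset.prod_const, hc, hc', neg_pow α]
  ring

theorem rootCoords_smul {n : ℕ} (c : Fin n → ℂ) (w : Fin n → Fin 2 → ℂ) :
    rootCoords (fun i => c i • w i) = (∏ i, c i) • rootCoords w := by
  funext j
  simp only [rootCoords, Pi.smul_apply, smul_eq_mul]
  rw [mul_left_comm, Finset.mul_sum (a := ∏ i, c i)]
  refine congrArg ((-1) ^ (j : ℕ) * ·) ?_
  refine Finset.sum_congr rfl fun S _ => ?_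
  rw [Finset.prod_mul_distrib, Finset.prod_mul_distrib, ← Finset.prod_mul_prod_compl S c]
  ring

theorem rootCoords_comp_perm {n : ℕ} (w : Fin n → Fin 2 → ℂ) (σ : Equiv.Perm (Fin n)) :
    rootCoords (fun i => w (σ i)) = rootCoords w := by
  funext j
  refine congrArg ((-1) ^ (j : ℕ) * ·) ?_
  refine Finset.sum_equiv (Equiv.finsetCongr σ) (fun S => ?_) fun S _ => ?_
  · simp [Finset.mem_powersetCard, Equiv.finsetCongr]
  have : (Equiv.finsetCongr σ S)ᶜ = Equiv.finsetCongr σ Sᶜ := by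
    ext i; simp [Equiv.finsetCongr]
  rw [this]
  simp [Equiv.finsetCongr]

/-- At `(α, β) = (-t, 1)` the associated form is `∏ (u_i + t v_i)`, which is nonzero for a suitable
`t`. -/
theorem rootCoords_ne_zero {n : ℕ} {w : Fin n → Fin 2 → ℂ} (hw : ∀ i, w i ≠ 0) :
    rootCoords w ≠ 0 := by
  obtain ⟨t, ht⟩ := exists_forall_add_mul_ne_zero w hw
  intro h
  have h1 := binaryForm_rootCoords w (-t) 1
  rw [h] at h1
  refine Finset.prod_ne_zero_iff.2 (fun i _ => ?_) (h1.symm.trans (by simp [binaryForm]))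
  simpa using ht i

open Polynomial in
theorem eq_zero_of_forall_binaryForm_eq_zero {n : ℕ} {p : Fin (n + 1) → ℂ} {s : Set ℂ}
    (hs : s.Finite) (h : ∀ x ∉ s, binaryForm p x 1 = 0) : p = 0 := by
  have h0 : (∑ j : Fin (n + 1), C (p j) * X ^ (j : ℕ) : ℂ[X]) = 0 := by
    refine Polynomial.eq_zero_of_infinite_isRoot _ (hs.infinite_compl.mono fun x hx => ?_)
    simpa [binaryForm, eval_finsetSum] using h x hx
  funext j
  have := congrArg (fun q => coeff q (j : ℕ)) h0
  simpa [finsetSum_coeff, coeff_C_mul, coeff_X_pow, Fin.val_inj] using this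

/-! ### Tuples in an affine chart as roots of a monic polynomial -/

/-- The vector `(u, v)` with `u + t v = 1` and `v = z`. -/
def affineLift (t z : ℂ) : Fin 2 → ℂ := ![1 - t * z, z]

theorem affineLift_ne_zero (t z : ℂ) : affineLift t z ≠ 0 := by
  intro h
  have h0 : 1 - t * z = 0 := congrFun h 0
  have h1 : z = 0 := congrFun h 1
  simp [h1] at h0

/-- The substitution is chosen so that each factor becomes `x (1 - t z_i) + (1 + t x) z_i = x +
z_i`. -/
theorem binaryForm_rootCoords_affineLift {n : ℕ} (t : ℂ) (z : Fin n → ℂ) (x : ℂ) :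
    binaryForm (rootCoords fun i => affineLift t (z i)) (-(1 + t * x)) x = ∏ i, (x + z i) := by
  rw [binaryForm_rootCoords]
  refine Finset.prod_congr rfl fun i _ => ?_
  simp [affineLift]
  ring

theorem binaryForm_rootCoords_affineLift_neg {n : ℕ} (t : ℂ) (z : Fin n → ℂ) :
    binaryForm (rootCoords fun i => affineLift t (z i)) (-t) 1 = 1 := by
  rw [binaryForm_rootCoords]
  refine Finset.prod_eq_one fun i _ => ?_
  simp [affineLift]

open Polynomial in
/-- The polynomial `x ↦ ∑ p_j α ^ j β ^ (n - j)` with `α = -(1 + t x)` and `β = x`. -/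
noncomputable def affineForm {n : ℕ} (t : ℂ) (p : Fin (n + 1) → ℂ) : ℂ[X] :=
  ∑ j : Fin (n + 1), C (p j) * ((-(1 + C t * X)) ^ (j : ℕ) * X ^ (n - (j : ℕ)))

theorem eval_affineForm {n : ℕ} (t : ℂ) (p : Fin (n + 1) → ℂ) (x : ℂ) :
    (affineForm t p).eval x = binaryForm p (-(1 + t * x)) x := by
  simp [affineForm, binaryForm, Polynomial.eval_finsetSum]

open Polynomial in
theorem affineForm_rootCoords_affineLift {n : ℕ} (t : ℂ) (z : Fin n → ℂ) :
    affineForm t (rootCoords fun i => affineLift t (z i)) = ∏ i, (X + C (z i)) := by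
  refine Polynomial.funext fun x => ?_
  rw [eval_affineForm, binaryForm_rootCoords_affineLift]
  simp [eval_prod]

open Polynomial in
theorem natDegree_affineForm_le {n : ℕ} (t : ℂ) (p : Fin (n + 1) → ℂ) :
    (affineForm t p).natDegree ≤ n := by
  refine natDegree_sum_le_of_forall_le _ _ fun j _ => ?_
  have h1 : (-(1 + C t * X) : ℂ[X]).natDegree ≤ 1 := by compute_degree
  have h2 : ((-(1 + C t * X) : ℂ[X]) ^ (j : ℕ)).natDegree ≤ j :=
    (natDegree_pow_le_of_le _ h1).trans (by simp)
  refine (natDegree_C_mul_le _ _).trans ((natDegree_mul_le_of_le h2 (natDegree_X_pow_le _)).trans ?_)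
  omega

-- In each summand both factors attain at most their degree bounds `j` and `n - j`, so the
-- coefficient of degree `n` is the product of the two bounding coefficients. This works for `t = 0`
-- too. It is the value that has to be normalized to `1` for the polynomial to be monic.
open Polynomial in
theorem coeff_affineForm {n : ℕ} (t : ℂ) (p : Fin (n + 1) → ℂ) :
    (affineForm t p).coeff n = binaryForm p (-t) 1 := by
  rw [affineForm, finsetSum_coeff, binaryForm]
  refine Finset.sum_congr rfl fun j _ => ?_
  have h1 : (-(1 + C t * X) : ℂ[X]).natDegree ≤ 1 := by compute_degree
  have h2 : ((-(1 + C t * X) : ℂ[X]) ^ (j : ℕ)).natDegree ≤ j :=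
    (natDegree_pow_le_of_le _ h1).trans (by simp)
  have h3 := coeff_pow_of_natDegree_le (m := j) h1
  rw [mul_one] at h3
  have h4 := coeff_mul_add_eq_of_natDegree_le h2 (natDegree_X_pow_le (R := ℂ) (n - (j : ℕ)))
  rw [Nat.add_sub_cancel' (Nat.lt_succ_iff.1 j.2)] at h4
  rw [coeff_C_mul, h4, h3]
  simp [coeff_one]

-- The root multisets agree, so each value is taken equally often by both families; bijections
-- between the fibres glue to a permutation.
open Polynomial in
theorem exists_perm_of_prod_X_add_C_eq {n : ℕ} {y z : Fin n → ℂ}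
    (h : (∏ i, (X + C (y i)) : ℂ[X]) = ∏ i, (X + C (z i))) :
    ∃ σ : Equiv.Perm (Fin n), ∀ i, z i = y (σ i) := by
  have hr : ∀ y : Fin n → ℂ, (∏ i, (X + C (y i)) : ℂ[X]).roots =
      Finset.univ.val.map fun i => -y i := by
    intro y
    have : (∏ i, (X + C (y i)) : ℂ[X]) =
        ((Finset.univ.val.map fun i => -y i).map fun a => X - C a).prod := by
      simp [Finset.prod, Function.comp_def]
    rw [this, roots_multiset_prod_X_sub_C]
  have hm := congrArg roots h
  rw [hr, hr] at hm
  have hc : ∀ c : ℂ, Nonempty ({i // z i = c} ≃ {i // y i = c}) := by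
    intro c
    refine ⟨Fintype.equivOfCardEq ?_⟩
    have := congrArg (Multiset.count (-c)) hm
    rw [Multiset.count_map, Multiset.count_map] at this
    rw [Fintype.card_subtype, Fintype.card_subtype]
    simpa [Finset.card, neg_inj, eq_comm] using this.symm
  refine ⟨Equiv.ofFiberEquiv fun c => (hc c).some, fun i => ?_⟩
  exact (Equiv.ofFiberEquiv_map _ i).symm

open Polynomial in
/-- A vector at which the form `∑ p_j (-t) ^ j` takes the value `1` consists of the root coordinates
of points in the affine chart. -/
theorem exists_rootCoords_affineLift_eq {n : ℕ} {t : ℂ} {p : Fin (n + 1) → ℂ}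
    (hp : binaryForm p (-t) 1 = 1) : ∃ z : Fin n → ℂ, rootCoords (fun i => affineLift t (z i)) = p := by
  have hd : (affineForm t p).natDegree = n :=
    le_antisymm (natDegree_affineForm_le t p)
      (le_natDegree_of_ne_zero (by rw [coeff_affineForm, hp]; exact one_ne_zero))
  have hm : (affineForm t p).Monic := by
    rw [Monic, leadingCoeff, hd, coeff_affineForm, hp]
  have hs := IsAlgClosed.splits (affineForm t p)
  have hcard : (affineForm t p).roots.card = n := by rw [← hs.natDegree_eq_card_roots, hd]
  have hl : (affineForm t p).roots.toList.length = n := by simpa using hcard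
  -- The sign is there because the factor `X + z_i` has the root `-z_i`.
  refine ⟨fun i => -(affineForm t p).roots.toList.get (Fin.cast hl.symm i), ?_⟩
  set z : Fin n → ℂ := fun i => -(affineForm t p).roots.toList.get (Fin.cast hl.symm i) with hz
  have he : affineForm t p = ∏ i, (X + C (z i)) := by
    conv_lhs => rw [hs.eq_prod_roots_of_monic hm]
    have h1 : (affineForm t p).roots = ((affineForm t p).roots.toList : Multiset ℂ) := by simp
    rw [h1, Multiset.map_coe, Multiset.prod_coe, ← List.ofFn_get (l := (affineForm t p).roots.toList),
      List.map_ofFn, List.prod_ofFn]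
    refine Fintype.prod_equiv (finCongr (by simpa using hcard)) _ _ fun i => ?_
    simp [hz, sub_eq_add_neg]
  rw [← sub_eq_zero]
  -- It remains to recover a form from its affine polynomial. The points `(-(1 + t y) : y)` are all
  -- points of the line except `(-t : 1)`; for `x ≠ -t`, the parameter `y = -(x + t)⁻¹` gives `(x :
  -- 1)`.
  refine eq_zero_of_forall_binaryForm_eq_zero (Set.finite_singleton (-t)) fun x hx => ?_
  have hx : x + t ≠ 0 := fun h => hx (by simpa using eq_neg_of_add_eq_zero_left h)
  have h0 : ∀ x, binaryForm (rootCoords (fun i => affineLift t (z i)) - p) (-(1 + t * x)) x = 0 := by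
    intro x
    rw [binaryForm_sub, ← eval_affineForm, ← eval_affineForm, affineForm_rootCoords_affineLift, he,
      sub_self]
  have h1 := h0 (-(x + t)⁻¹)
  have h2 : -(1 + t * -(x + t)⁻¹) = -(x + t)⁻¹ * x := by field_simp; ring
  have h3 : -(x + t)⁻¹ = -(x + t)⁻¹ * 1 := (mul_one _).symm
  rw [h2] at h1
  nth_rw 2 [h3] at h1
  rw [binaryForm_mul_mul] at h1
  exact (mul_eq_zero.1 h1).resolve_left (pow_ne_zero _ (neg_ne_zero.2 (inv_ne_zero hx)))

theorem exists_perm_of_rootCoords_affineLift_eq {n : ℕ} {t : ℂ} {y z : Fin n → ℂ}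
    (h : rootCoords (fun i => affineLift t (y i)) = rootCoords fun i => affineLift t (z i)) :
    ∃ σ : Equiv.Perm (Fin n), ∀ i, z i = y (σ i) := by
  have := congrArg (affineForm t) h
  rw [affineForm_rootCoords_affineLift, affineForm_rootCoords_affineLift] at this
  exact exists_perm_of_prod_X_add_C_eq this

/-- The elementary symmetric functions of the affine coordinates are linear in the root
coordinates. -/
theorem eval_esymm_eq_coeff_affineForm {n : ℕ} (t : ℂ) (z : Fin n → ℂ) {k : ℕ} (hk : k ≤ n) :
    MvPolynomial.eval z (MvPolynomial.esymm (Fin n) ℂ k) =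
      (affineForm t (rootCoords fun i => affineLift t (z i))).coeff (n - k) := by
  rw [affineForm_rootCoords_affineLift, Finset.prod_X_add_C_coeff _ _ (by simp)]
  simp [MvPolynomial.esymm, Nat.sub_sub_self hk]

/-! ### Symmetrization of polynomials -/

open MvPolynomial in
/-- The symmetrization of a suitable multiple of a polynomial does not vanish at a given point
where the polynomial does not vanish. -/
theorem exists_eval_sum_rename_mul_ne_zero {n : ℕ} {z : Fin n → ℂ} {B : MvPolynomial (Fin n) ℂ}
    (hB : eval z B ≠ 0) : ∃ G : MvPolynomial (Fin n) ℂ,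
      eval z (∑ σ : Equiv.Perm (Fin n), rename σ (G * B)) ≠ 0 := by
  classical
  -- `T` is the orbit of `z` without `z`. The multiplier vanishes on `T`, so only the stabilizer of
  -- `z` contributes to the sum, and all its terms are equal: in characteristic zero nothing
  -- cancels.
  let T : Finset (Fin n → ℂ) :=
    (Finset.univ.image fun σ : Equiv.Perm (Fin n) => fun i => z (σ i)).erase z
  have hT : ∀ v ∈ T, ∃ i, z i ≠ v i := by
    intro v hv
    by_contra! h
    exact Finset.ne_of_mem_erase hv (funext fun i => (h i).symm)
  have hG : ∀ v ∈ T, ∃ g : MvPolynomial (Fin n) ℂ, eval z g ≠ 0 ∧ eval v g = 0 := by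
    intro v hv
    obtain ⟨i, hi⟩ := hT v hv
    exact ⟨X i - C (v i), by simpa [sub_eq_zero] using hi, by simp⟩
  choose! g hg1 hg2 using hG
  refine ⟨∏ v ∈ T, g v, ?_⟩
  have hz : eval z (∏ v ∈ T, g v) ≠ 0 := by
    rw [map_prod]
    exact Finset.prod_ne_zero_iff.2 hg1
  have h : ∀ σ : Equiv.Perm (Fin n), eval z (rename σ ((∏ v ∈ T, g v) * B)) =
      if z ∘ σ = z then eval z (∏ v ∈ T, g v) * eval z B else 0 := by
    intro σ
    rw [eval_rename, map_mul]
    split_ifs with hσ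
    · rw [hσ]
    · have hm : z ∘ σ ∈ T :=
        Finset.mem_erase.2 ⟨hσ, Finset.mem_image.2 ⟨σ, Finset.mem_univ _, rfl⟩⟩
      rw [map_prod, Finset.prod_eq_zero hm (hg2 _ hm), zero_mul]
  rw [map_sum, Finset.sum_congr rfl fun σ _ => h σ, ← Finset.sum_filter, Finset.sum_const,
    nsmul_eq_mul]
  refine mul_ne_zero (Nat.cast_ne_zero.2 (Finset.card_ne_zero_of_mem (a := 1) ?_)) (mul_ne_zero hz hB)
  exact Finset.mem_filter.2 ⟨Finset.mem_univ _, rfl⟩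

open MvPolynomial in
theorem isSymmetric_sum_rename {n : ℕ} (A : MvPolynomial (Fin n) ℂ) :
    (∑ σ : Equiv.Perm (Fin n), rename σ A).IsSymmetric := by
  intro τ
  rw [map_sum]
  refine Fintype.sum_equiv (Equiv.mulLeft τ) _ _ fun σ => ?_
  rw [rename_rename]
  rfl

/-! ### Local fractions of polynomials in given coordinates -/

section PolyNhds

open MvPolynomial

variable {Y κ : Type*} (C : Set Y) (z : Y → κ → ℂ)

/-- The filter generated by the principal open subsets around `x` of a set `C` on which polynomials
in the coordinates `z` are defined. -/
def polyNhds (x : Y) : Filter Y where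
  sets := {S | ∃ B : MvPolynomial κ ℂ, eval (z x) B ≠ 0 ∧ ∀ y ∈ C, eval (z y) B ≠ 0 → y ∈ S}
  univ_sets := ⟨1, by simp, fun _ _ _ => Set.mem_univ _⟩
  sets_of_superset := fun ⟨B, hB, h⟩ hs => ⟨B, hB, fun y hy h0 => hs (h y hy h0)⟩
  inter_sets := by
    rintro S T ⟨B, hB, h⟩ ⟨B', hB', h'⟩
    refine ⟨B * B', by simpa using ⟨hB, hB'⟩, fun y hy h0 => ?_⟩
    rw [map_mul] at h0
    exact ⟨h y hy (left_ne_zero_of_mul h0), h' y hy (right_ne_zero_of_mul h0)⟩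

variable {C z} {x : Y}

theorem polyNhds_eval_ne_zero {B : MvPolynomial κ ℂ} (hB : eval (z x) B ≠ 0) :
    ∀ᶠ y in polyNhds C z x, eval (z y) B ≠ 0 := ⟨B, hB, fun _ _ h => h⟩

theorem polyNhds_mem : ∀ᶠ y in polyNhds C z x, y ∈ C := ⟨1, by simp, fun _ h _ => h⟩

theorem pure_le_polyNhds (hx : x ∈ C) : pure x ≤ polyNhds C z x :=
  fun _ ⟨_, hB, h⟩ => h x hx hB

variable (C z x) in
/-- A function that is near `x` a quotient of polynomials in the coordinates `z`. -/
def IsPolyFraction (f : Y → ℂ) : Prop :=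
  ∃ A B : MvPolynomial κ ℂ, eval (z x) B ≠ 0 ∧
    ∀ᶠ y in polyNhds C z x, f y = eval (z y) A / eval (z y) B

namespace IsPolyFraction

variable {f g : Y → ℂ}

theorem congr (hf : IsPolyFraction C z x f) (h : ∀ᶠ y in polyNhds C z x, f y = g y) :
    IsPolyFraction C z x g := by
  obtain ⟨A, B, hB, he⟩ := hf
  refine ⟨A, B, hB, ?_⟩
  filter_upwards [he, h] with y h1 h2
  rw [← h2, h1]

theorem eval (P : MvPolynomial κ ℂ) : IsPolyFraction C z x fun y => MvPolynomial.eval (z y) P :=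
  ⟨P, 1, by simp, Filter.Eventually.of_forall fun y => by simp⟩

theorem const (c : ℂ) : IsPolyFraction C z x fun _ => c := by
  simpa using eval (C := C) (z := z) (x := x) (MvPolynomial.C c)

theorem add (hf : IsPolyFraction C z x f) (hg : IsPolyFraction C z x g) :
    IsPolyFraction C z x fun y => f y + g y := by
  obtain ⟨A, B, hB, he⟩ := hf
  obtain ⟨A', B', hB', he'⟩ := hg
  refine ⟨A * B' + B * A', B * B', by simpa using ⟨hB, hB'⟩, ?_⟩
  filter_upwards [he, he', polyNhds_eval_ne_zero hB, polyNhds_eval_ne_zero hB'] with y h1 h2 h3 h4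
  rw [h1, h2, div_add_div _ _ h3 h4]
  simp

theorem mul (hf : IsPolyFraction C z x f) (hg : IsPolyFraction C z x g) :
    IsPolyFraction C z x fun y => f y * g y := by
  obtain ⟨A, B, hB, he⟩ := hf
  obtain ⟨A', B', hB', he'⟩ := hg
  refine ⟨A * A', B * B', by simpa using ⟨hB, hB'⟩, ?_⟩
  filter_upwards [he, he'] with y h1 h2
  rw [h1, h2, div_mul_div_comm]
  simp

theorem sum {ι : Type*} (s : Finset ι) {f : ι → Y → ℂ} (hf : ∀ i, IsPolyFraction C z x (f i)) :
    IsPolyFraction C z x fun y => ∑ i ∈ s, f i y := by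
  classical
  induction s using Finset.induction_on with
  | empty => simpa using const 0
  | insert i s hi ih => simpa [Finset.sum_insert hi] using (hf i).add ih

theorem prod {ι : Type*} (s : Finset ι) {f : ι → Y → ℂ} (hf : ∀ i, IsPolyFraction C z x (f i)) :
    IsPolyFraction C z x fun y => ∏ i ∈ s, f i y := by
  classical
  induction s using Finset.induction_on with
  | empty => simpa using const 1
  | insert i s hi ih => simpa [Finset.prod_insert hi] using (hf i).mul ih

theorem eval_ne_zero (hx : x ∈ C) {A B : MvPolynomial κ ℂ} (h0 : f x ≠ 0)
    (he : ∀ᶠ y in polyNhds C z x, f y = MvPolynomial.eval (z y) A / MvPolynomial.eval (z y) B) :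
    MvPolynomial.eval (z x) A ≠ 0 := by
  intro h
  have h1 : f x = MvPolynomial.eval (z x) A / MvPolynomial.eval (z x) B := pure_le_polyNhds hx he
  exact h0 (by rw [h1, h, zero_div])

theorem inv (hx : x ∈ C) (hf : IsPolyFraction C z x f) (h0 : f x ≠ 0) :
    IsPolyFraction C z x fun y => (f y)⁻¹ := by
  obtain ⟨A, B, hB, he⟩ := hf
  refine ⟨B, A, eval_ne_zero hx h0 he, ?_⟩
  filter_upwards [he] with y h1
  rw [h1, inv_div]

theorem ne_zero (hx : x ∈ C) (hf : IsPolyFraction C z x f) (h0 : f x ≠ 0) :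
    ∀ᶠ y in polyNhds C z x, f y ≠ 0 := by
  obtain ⟨A, B, hB, he⟩ := hf
  filter_upwards [he, polyNhds_eval_ne_zero hB, polyNhds_eval_ne_zero (eval_ne_zero hx h0 he)]
    with y h1 h2 h3
  rw [h1]
  exact div_ne_zero h3 h2

/-- A polynomial fraction can be given by numerators and denominators that are valid on all
of `C`. -/
theorem exists_mul_eq (hf : IsPolyFraction C z x f) : ∃ A B : MvPolynomial κ ℂ,
    MvPolynomial.eval (z x) B ≠ 0 ∧
      ∀ y ∈ C, f y * MvPolynomial.eval (z y) B = MvPolynomial.eval (z y) A := by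
  obtain ⟨A, B, hB, D, hD, he⟩ := hf
  -- `f = A / B` is known only where `D ≠ 0`. The extra factors `B` and `D` make both sides vanish
  -- wherever that formula is unavailable.
  refine ⟨A * B * D, B * B * D, by simpa using ⟨hB, hD⟩, fun y hy => ?_⟩
  simp only [map_mul]
  by_cases h1 : MvPolynomial.eval (z y) D = 0
  · simp [h1]
  by_cases h2 : MvPolynomial.eval (z y) B = 0
  · simp [h2]
  rw [show f y = _ from he y hy h1]
  field_simp

end IsPolyFraction

end PolyNhds

/-! ### Homogeneous polynomials and representatives of projective points -/

namespace MvPolynomial.IsHomogeneous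

variable {σ : Type*} {d : ℕ} {F G : MvPolynomial σ ℂ}

theorem eval_smul_eq (hF : F.IsHomogeneous d) (c : ℂ) (v : σ → ℂ) :
    MvPolynomial.eval (c • v) F = c ^ d * MvPolynomial.eval v F := by
  classical
  rw [MvPolynomial.eval_eq, MvPolynomial.eval_eq, Finset.mul_sum]
  refine Finset.sum_congr rfl fun m hm => ?_
  have h := hF (MvPolynomial.mem_support_iff.1 hm)
  simp only [Pi.smul_apply, smul_eq_mul, mul_pow, Finset.prod_mul_distrib, Finset.prod_pow_eq_pow_sum]
  rw [← h, Finsupp.weight_apply]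
  simp [Finsupp.sum]
  ring

variable {n : ℕ} {F G : MvPolynomial (Fin (n + 1)) ℂ}

theorem eval_rep_mk_eq_zero_iff (hF : F.IsHomogeneous d) {p : Fin (n + 1) → ℂ} (hp : p ≠ 0) :
    MvPolynomial.eval (Projectivization.mk ℂ p hp).rep F = 0 ↔ MvPolynomial.eval p F = 0 := by
  obtain ⟨a, ha⟩ := Projectivization.exists_smul_eq_mk_rep ℂ p hp
  rw [← ha, Units.smul_def, hF.eval_smul_eq]
  simp

theorem eval_rep_mk_div (hF : F.IsHomogeneous d) (hG : G.IsHomogeneous d) {p : Fin (n + 1) → ℂ}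
    (hp : p ≠ 0) : MvPolynomial.eval (Projectivization.mk ℂ p hp).rep F /
      MvPolynomial.eval (Projectivization.mk ℂ p hp).rep G =
        MvPolynomial.eval p F / MvPolynomial.eval p G := by
  obtain ⟨a, ha⟩ := Projectivization.exists_smul_eq_mk_rep ℂ p hp
  rw [← ha, Units.smul_def, hF.eval_smul_eq, hG.eval_smul_eq,
    mul_div_mul_left _ _ (pow_ne_zero _ a.ne_zero)]

end MvPolynomial.IsHomogeneous

/-! ### Affine charts of the projective line and of its powers -/

/-- The affine coordinate `v / (u + t v)` of a point `(u : v)` of the projective line. -/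
noncomputable def affineCoord (t : ℂ) (x : ℙ ℂ (Fin 2 → ℂ)) : ℂ :=
  x.rep 1 / (x.rep 0 + t * x.rep 1)

/-- The affine chart `u + t v ≠ 0` of the projective line. -/
def affineChart (t : ℂ) : Set (ℙ ℂ (Fin 2 → ℂ)) := {x | x.rep 0 + t * x.rep 1 ≠ 0}

theorem mk_affineLift_affineCoord {t : ℂ} {x : ℙ ℂ (Fin 2 → ℂ)} (hx : x ∈ affineChart t) :
    Projectivization.mk ℂ (affineLift t (affineCoord t x)) (affineLift_ne_zero _ _) = x := by
  conv_rhs => rw [← x.mk_rep]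
  rw [Projectivization.mk_eq_mk_iff']
  have hx : x.rep 0 + t * x.rep 1 ≠ 0 := hx
  refine ⟨(x.rep 0 + t * x.rep 1)⁻¹, funext fun j => ?_⟩
  fin_cases j
  · simp [affineLift, affineCoord]
    field_simp
    ring
  · simp [affineLift, affineCoord]
    field_simp

open MvPolynomial in
theorem MvPolynomial.eval_aeval_eq {κ ι : Type*} (z : κ → ℂ) (g : ι → MvPolynomial κ ℂ)
    (F : MvPolynomial ι ℂ) : eval z (aeval g F) = eval (fun j => eval z (g j)) F := by
  induction F using MvPolynomial.induction_on with
  | C a => simp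
  | add p q hp hq => rw [map_add, map_add, map_add, hp, hq]
  | mul_X p i hp => rw [map_mul, map_mul, map_mul, hp, aeval_X, eval_X]

/-- The filter of principal open subsets around a point of an affine chart of the projective
line. -/
noncomputable def lineNhds (t : ℂ) (x : ℙ ℂ (Fin 2 → ℂ)) : Filter (ℙ ℂ (Fin 2 → ℂ)) :=
  polyNhds (affineChart t) (fun y (_ : Unit) => affineCoord t y) x

/-- The `n`-th power of an affine chart of the projective line. -/
def affineBox (n : ℕ) (t : ℂ) : Set (Fin n → ℙ ℂ (Fin 2 → ℂ)) := {x | ∀ i, x i ∈ affineChart t}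

/-- The affine coordinates of a tuple of points of the projective line. -/
noncomputable def affineCoords {n : ℕ} (t : ℂ) (x : Fin n → ℙ ℂ (Fin 2 → ℂ)) : Fin n → ℂ :=
  fun i => affineCoord t (x i)

-- Dehomogenization: on the chart, the representative is `u + t v` times the normalized vector `(1 -
-- t z, z)`, and `F` is homogeneous.
open MvPolynomial in
theorem exists_eval_rep_eq {d : ℕ} {F : MvPolynomial (Fin 2) ℂ} (hF : F.IsHomogeneous d) (t : ℂ) :
    ∃ A : MvPolynomial Unit ℂ, ∀ y ∈ affineChart t, eval y.rep F =
      (y.rep 0 + t * y.rep 1) ^ d * eval (fun _ : Unit => affineCoord t y) A := by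
  refine ⟨aeval ![1 - C t * X (), X ()] F, fun y hy => ?_⟩
  rw [eval_aeval_eq, ← hF.eval_smul_eq]
  congr 2
  have hy : y.rep 0 + t * y.rep 1 ≠ 0 := hy
  funext j
  fin_cases j
  · simp [affineCoord]
    field_simp
    ring
  · simpa [affineCoord] using (mul_div_cancel₀ (y.rep 1) hy).symm

theorem lineNhds_le_nhds {t : ℂ} {x : projectiveSpace 1} (hx : x ∈ affineChart t) :
    lineNhds t x ≤ 𝓝 x := by
  refine le_of_le_of_eq ?_ TopologicalSpace.nhds_generateFrom.symm
  refine le_iInf₂ fun W hW => Filter.le_principal_iff.2 ?_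
  obtain ⟨hxW, d, F, hF, rfl⟩ := hW
  obtain ⟨A, hA⟩ := exists_eval_rep_eq hF t
  refine ⟨A, fun h => hxW ?_, fun y hy h => ?_⟩
  · rw [hA x hx, h, mul_zero]
  · change MvPolynomial.eval y.rep F ≠ 0
    rw [hA y hy]
    exact mul_ne_zero (pow_ne_zero _ hy) h

theorem isPolyFraction_of_regularAt_line {t : ℂ} {x : projectiveSpace 1} (hx : x ∈ affineChart t)
    {f : projectiveSpace 1 → ℂ} (hf : (projectiveSpace 1).RegularAt f x) :
    IsPolyFraction (affineChart t) (fun y (_ : Unit) => affineCoord t y) x f := by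
  obtain ⟨d, F, G, hF, hG, h0, he⟩ := hf
  obtain ⟨A, hA⟩ := exists_eval_rep_eq hF t
  obtain ⟨B, hB⟩ := exists_eval_rep_eq hG t
  refine ⟨A, B, fun h => h0 ?_, ?_⟩
  · rw [hB x hx, h, mul_zero]
  · filter_upwards [lineNhds_le_nhds hx he, polyNhds_mem (x := x)] with y h1 h2
    refine Eq.trans h1 ?_
    rw [hA y h2, hB y h2, mul_div_mul_left _ _ (pow_ne_zero _ h2)]

open MvPolynomial in
theorem tendsto_apply_polyNhds {n : ℕ} (t : ℂ) (x : Fin n → ℙ ℂ (Fin 2 → ℂ)) (i : Fin n) :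
    Filter.Tendsto (fun y => y i) (polyNhds (affineBox n t) (affineCoords t) x)
      (lineNhds t (x i)) := by
  rintro S ⟨B, hB, h⟩
  refine ⟨rename (fun _ => i) B, ?_, fun y hy h0 => h _ (hy i) ?_⟩
  · rw [eval_rename]
    exact hB
  · rw [eval_rename] at h0
    exact h0

open MvPolynomial in
theorem IsPolyFraction.comp_apply {n : ℕ} {t : ℂ} {x : Fin n → ℙ ℂ (Fin 2 → ℂ)} {i : Fin n}
    {f : ℙ ℂ (Fin 2 → ℂ) → ℂ}
    (hf : IsPolyFraction (affineChart t) (fun y (_ : Unit) => affineCoord t y) (x i) f) :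
    IsPolyFraction (affineBox n t) (affineCoords t) x fun y => f (y i) := by
  obtain ⟨A, B, hB, he⟩ := hf
  refine ⟨rename (fun _ => i) A, rename (fun _ => i) B, ?_, ?_⟩
  · rw [eval_rename]
    exact hB
  · filter_upwards [tendsto_apply_polyNhds t x i he] with y hy
    rw [eval_rename, eval_rename]
    exact hy

theorem eventually_apply_mem_polyNhds {n : ℕ} {t : ℂ} {x : Fin n → projectiveSpace 1}
    (hx : x ∈ affineBox n t) {U : Fin n → Set (projectiveSpace 1)} (hU : ∀ i, IsOpen (U i))
    (hxU : ∀ i, x i ∈ U i) :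
    ∀ᶠ y in polyNhds (affineBox n t) (affineCoords t) x, ∀ i, y i ∈ U i :=
  Filter.eventually_all.2 fun i => tendsto_apply_polyNhds t x i
    (lineNhds_le_nhds (hx i) ((hU i).mem_nhds (hxU i)))

theorem isPolyFraction_of_isTensor {n : ℕ} {t : ℂ} {x : Fin n → projectiveSpace 1}
    (hx : x ∈ affineBox n t) {U : Fin n → Set (projectiveSpace 1)} (hU : ∀ i, IsOpen (U i))
    (hxU : ∀ i, x i ∈ U i) {h : (Fin n → projectiveSpace 1) → ℂ}
    (hh : (projectiveSpace 1).IsTensor n U h) :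
    IsPolyFraction (affineBox n t) (affineCoords t) x h := by
  obtain ⟨m, c, f, hf, he⟩ := hh
  have h1 : IsPolyFraction (affineBox n t) (affineCoords t) x
      fun y => ∑ k, c k * ∏ i, f k i (y i) :=
    .sum _ fun k => (IsPolyFraction.const _).mul (.prod _ fun i =>
      (isPolyFraction_of_regularAt_line (hx i) (hf k i (x i) (hxU i))).comp_apply)
  refine h1.congr ?_
  filter_upwards [eventually_apply_mem_polyNhds hx hU hxU] with y hy
  exact (he y hy).symm

/-- The topology of the power is generated by nonvanishing loci of tensors on boxes, and near a
point of the chart a tensor is a polynomial fraction. This lets an arbitrary neighbourhood be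
replaced by the nonvanishing locus of a single polynomial. -/
theorem polyNhds_le_nhds_pow {n : ℕ} {t : ℂ} {x : (projectiveSpace 1).pow n}
    (hx : x ∈ affineBox n t) : polyNhds (affineBox n t) (affineCoords t) x ≤ 𝓝 x := by
  refine le_of_le_of_eq ?_ TopologicalSpace.nhds_generateFrom.symm
  refine le_iInf₂ fun W hW => Filter.le_principal_iff.2 ?_
  obtain ⟨hxW, U, h, hU, hh, rfl⟩ := hW
  filter_upwards [eventually_apply_mem_polyNhds hx hU hxW.1,
    (isPolyFraction_of_isTensor hx hU hxW.1 hh).ne_zero hx hxW.2] with y h1 h2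
  exact ⟨h1, h2⟩

theorem isPolyFraction_of_regularAt_pow {n : ℕ} {t : ℂ} {x : (projectiveSpace 1).pow n}
    (hx : x ∈ affineBox n t) {f : (projectiveSpace 1).pow n → ℂ}
    (hf : ((projectiveSpace 1).pow n).RegularAt f x) :
    IsPolyFraction (affineBox n t) (affineCoords t) x f := by
  obtain ⟨U, N, D, hU, hxU, hN, hD, h0, he⟩ := hf
  have h1 := (isPolyFraction_of_isTensor hx hU hxU hN).mul
    ((isPolyFraction_of_isTensor hx hU hxU hD).inv hx h0)
  refine h1.congr ?_
  filter_upwards [polyNhds_le_nhds_pow hx he] with y hy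
  exact hy.symm

/-! ### Regularity of polynomials in the affine coordinates -/

namespace SpaceWithFunctions

theorem regularAt_eval {X : SpaceWithFunctions} {κ : Type*} {g : κ → X → ℂ} {x : X}
    (hg : ∀ k, X.RegularAt (g k) x) (P : MvPolynomial κ ℂ) :
    X.RegularAt (fun y => MvPolynomial.eval (fun k => g k y) P) x := by
  induction P using MvPolynomial.induction_on with
  | C a => simpa using X.const a x
  | add p q hp hq => simpa using X.add hp hq
  | mul_X p i hp => simpa using X.mul hp (hg i)

theorem regularAt_comp_apply {X : SpaceWithFunctions} {n : ℕ} {i : Fin n} {x : X.pow n}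
    {f : X → ℂ} (hf : X.RegularAt f ((show Fin n → X from x) i)) :
    (X.pow n).RegularAt (fun y : Fin n → X => f (y i)) x := by
  -- A tensor needs factors regular on whole sides of a box, so the `i`-th side is shrunk to `V`;
  -- the other sides carry the constant `1`.
  obtain ⟨V, hV, hVo, hxV⟩ := eventually_nhds_iff.1 (X.eventually hf)
  refine ⟨fun j => if j = i then V else Set.univ, fun y => f (y i), fun _ => 1, ?_, ?_, ?_,
    IsTensor.const _ _, one_ne_zero, Filter.Eventually.of_forall fun y => by simp⟩
  · intro j
    beta_reduce
    split_ifs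
    exacts [hVo, isOpen_univ]
  · intro j
    by_cases hj : j = i
    · subst hj
      simpa using hxV
    · simp [hj]
  · refine ⟨1, fun _ => 1, fun _ j => if j = i then f else fun _ => 1, ?_, ?_⟩
    · intro _ j y hy
      by_cases hj : j = i
      · simp only [hj, if_true] at hy ⊢
        exact hV y hy
      · simp only [hj, if_false]
        exact X.const 1 y
    · intro y _
      simp [ite_apply]

end SpaceWithFunctions

open MvPolynomial in
theorem regularAt_affineCoord {t : ℂ} {x : projectiveSpace 1} (hx : x ∈ affineChart t) :
    (projectiveSpace 1).RegularAt (affineCoord t) x := by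
  refine ⟨1, X 1, X 0 + C t * X 1, isHomogeneous_X _ _,
    (isHomogeneous_X _ _).add ((isHomogeneous_X _ _).C_mul _), ?_,
    Filter.Eventually.of_forall fun y => ?_⟩
  · simpa using (show _ ≠ (0 : ℂ) from hx)
  · simp [affineCoord]

theorem eventually_mem_affineBox {n : ℕ} {t : ℂ} {x : (projectiveSpace 1).pow n}
    (hx : x ∈ affineBox n t) : ∀ᶠ y : (projectiveSpace 1).pow n in 𝓝 x, y ∈ affineBox n t := by
  have hx : ∀ i, (show Fin n → projectiveSpace 1 from x) i ∈ affineChart t := hx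
  refine Filter.eventually_all.2 fun i => ?_
  have hF : (MvPolynomial.X 0 + MvPolynomial.C t * MvPolynomial.X 1 :
      MvPolynomial (Fin 2) ℂ).IsHomogeneous 1 :=
    (MvPolynomial.isHomogeneous_X _ _).add ((MvPolynomial.isHomogeneous_X _ _).C_mul _)
  have h := eventually_eval_ne_zero hF (p := (show Fin n → projectiveSpace 1 from x) i)
    (by simpa using (show _ ≠ (0 : ℂ) from hx i))
  have h2 := (SpaceWithFunctions.continuous_proj (X := projectiveSpace 1) i).continuousAt (x := x)
  filter_upwards [h2.eventually h] with y hy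
  change _ ≠ (0 : ℂ)
  simpa using hy

theorem regularAt_eval_affineCoords {n : ℕ} {t : ℂ} {x : (projectiveSpace 1).pow n}
    (hx : x ∈ affineBox n t) (P : MvPolynomial (Fin n) ℂ) :
    ((projectiveSpace 1).pow n).RegularAt (fun y => MvPolynomial.eval (affineCoords t y) P) x :=
  SpaceWithFunctions.regularAt_eval
    (fun i => SpaceWithFunctions.regularAt_comp_apply (regularAt_affineCoord (hx i))) P

/-! ### The root map and its fibres -/

/-- The point of `ℂℙⁿ` attached to `n` points of the projective line. -/
noncomputable def rootPoint {n : ℕ} (x : Fin n → ℙ ℂ (Fin 2 → ℂ)) : ℙ ℂ (Fin (n + 1) → ℂ) :=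
  Projectivization.mk ℂ (rootCoords fun i => (x i).rep)
    (rootCoords_ne_zero fun i => (x i).rep_nonzero)

/-- Root coordinates are multilinear, so rescaling the vectors multiplies them by the product of the
scalars. -/
theorem rootPoint_mk {n : ℕ} {w : Fin n → Fin 2 → ℂ} (hw : ∀ i, w i ≠ 0) :
    rootPoint (fun i => Projectivization.mk ℂ (w i) (hw i)) =
      Projectivization.mk ℂ (rootCoords w) (rootCoords_ne_zero hw) := by
  choose c hc using fun i => Projectivization.exists_smul_eq_mk_rep ℂ (w i) (hw i)
  rw [rootPoint, Projectivization.mk_eq_mk_iff']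
  refine ⟨∏ i, (c i : ℂ), ?_⟩
  rw [← rootCoords_smul]
  simp_rw [← hc]
  rfl

theorem rootPoint_eq_mk_affineLift {n : ℕ} {t : ℂ} {x : Fin n → ℙ ℂ (Fin 2 → ℂ)}
    (hx : x ∈ affineBox n t) : rootPoint x =
      Projectivization.mk ℂ (rootCoords fun i => affineLift t (affineCoords t x i))
        (rootCoords_ne_zero fun _ => affineLift_ne_zero _ _) := by
  rw [← rootPoint_mk fun _ => affineLift_ne_zero _ _]
  exact congrArg rootPoint (funext fun i => (mk_affineLift_affineCoord (hx i)).symm)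

theorem rootPoint_comp_perm {n : ℕ} (x : Fin n → ℙ ℂ (Fin 2 → ℂ)) (σ : Equiv.Perm (Fin n)) :
    rootPoint (fun i => x (σ i)) = rootPoint x := by
  rw [rootPoint, rootPoint, Projectivization.mk_eq_mk_iff']
  exact ⟨1, by rw [one_smul]; exact (rootCoords_comp_perm (fun i => (x i).rep) σ).symm⟩

theorem binaryForm_rep_rootPoint_eq_zero_iff {n : ℕ} (x : Fin n → ℙ ℂ (Fin 2 → ℂ)) (α β : ℂ) :
    binaryForm (rootPoint x).rep α β = 0 ↔ ∃ i, β * (x i).rep 0 - α * (x i).rep 1 = 0 := by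
  obtain ⟨c, hc⟩ := Projectivization.exists_smul_eq_mk_rep ℂ (rootCoords fun i => (x i).rep)
    (rootCoords_ne_zero fun i => (x i).rep_nonzero)
  rw [rootPoint, ← hc, Units.smul_def, binaryForm_smul, binaryForm_rootCoords]
  simp [Finset.prod_eq_zero_iff]

/-- Shows that the box is the full preimage of the complement of a hyperplane, so it can be tested
on `ℂℙⁿ`. -/
theorem mem_affineBox_iff {n : ℕ} {t : ℂ} {x : Fin n → ℙ ℂ (Fin 2 → ℂ)} :
    x ∈ affineBox n t ↔ binaryForm (rootPoint x).rep (-t) 1 ≠ 0 := by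
  rw [Ne, binaryForm_rep_rootPoint_eq_zero_iff, not_exists]
  simp [affineBox, affineChart]

theorem exists_mem_affineBox {n : ℕ} (x : Fin n → ℙ ℂ (Fin 2 → ℂ)) : ∃ t, x ∈ affineBox n t :=
  exists_forall_add_mul_ne_zero (fun i => (x i).rep) fun i => (x i).rep_nonzero

theorem rootPoint_surjective (n : ℕ) : Function.Surjective (rootPoint (n := n)) := by
  intro q
  obtain ⟨t, ht⟩ : ∃ t, binaryForm q.rep (-t) 1 ≠ 0 := by
    by_contra! h
    exact q.rep_nonzero (eq_zero_of_forall_binaryForm_eq_zero Set.finite_empty fun x _ => by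
      simpa using h (-x))
  -- The representative is rescaled so that its form takes the value `1` at `(-t, 1)`, as for tuples
  -- of normalized vectors.
  obtain ⟨z, hz⟩ := exists_rootCoords_affineLift_eq
    (p := (binaryForm q.rep (-t) 1)⁻¹ • q.rep) (t := t)
    (by rw [binaryForm_smul, inv_mul_cancel₀ ht])
  refine ⟨_, (rootPoint_mk fun i => affineLift_ne_zero t (z i)).trans ?_⟩
  conv_rhs => rw [← q.mk_rep]
  rw [Projectivization.mk_eq_mk_iff']
  exact ⟨_, hz.symm⟩

theorem exists_perm_of_rootPoint_eq {n : ℕ} {x y : Fin n → ℙ ℂ (Fin 2 → ℂ)}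
    (h : rootPoint x = rootPoint y) : ∃ σ : Equiv.Perm (Fin n), ∀ i, y i = x (σ i) := by
  obtain ⟨t, hx⟩ := exists_mem_affineBox x
  have hy : y ∈ affineBox n t := by rwa [mem_affineBox_iff, ← h, ← mem_affineBox_iff]
  rw [rootPoint_eq_mk_affineLift hx, rootPoint_eq_mk_affineLift hy,
    Projectivization.mk_eq_mk_iff'] at h
  obtain ⟨c, hc⟩ := h
  -- Both normalized forms take the value `1` at `(-t, 1)`, which forces the scalar `c` to be `1`.
  have h1 := congrArg (fun p => binaryForm p (-t) 1) hc
  simp only [binaryForm_smul, binaryForm_rootCoords_affineLift_neg, mul_one] at h1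
  rw [h1, one_smul] at hc
  obtain ⟨σ, hσ⟩ := exists_perm_of_rootCoords_affineLift_eq hc
  refine ⟨σ⁻¹, fun i => ?_⟩
  have h2 := hσ (σ⁻¹ i)
  rw [show σ (σ⁻¹ i) = i from σ.apply_symm_apply i] at h2
  rw [← mk_affineLift_affineCoord (hx (σ⁻¹ i)), ← mk_affineLift_affineCoord (hy i)]
  simp only [affineCoords] at h2
  simp only [h2]

/-! ### Continuity of the root map and pullback of regular functions -/

open MvPolynomial in
theorem exists_eval_rootCoords_affineLift (n : ℕ) (t : ℂ) (F : MvPolynomial (Fin (n + 1)) ℂ) :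
    ∃ P : MvPolynomial (Fin n) ℂ, ∀ z : Fin n → ℂ,
      eval (rootCoords fun i => affineLift t (z i)) F = eval z P := by
  refine ⟨aeval (fun j : Fin (n + 1) => (-1 : MvPolynomial (Fin n) ℂ) ^ (j : ℕ) *
    ∑ S ∈ (Finset.univ : Finset (Fin n)).powersetCard j,
      (∏ i ∈ S, X i) * ∏ i ∈ Sᶜ, (1 - C t * X i)) F, fun z => ?_⟩
  rw [eval_aeval_eq]
  congr 2
  funext j
  simp [rootCoords, affineLift]

theorem eval_rep_rootPoint_eq_zero_iff {n d : ℕ} {F : MvPolynomial (Fin (n + 1)) ℂ}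
    (hF : F.IsHomogeneous d) {t : ℂ} {x : Fin n → ℙ ℂ (Fin 2 → ℂ)} (hx : x ∈ affineBox n t) :
    MvPolynomial.eval (rootPoint x).rep F = 0 ↔
      MvPolynomial.eval (rootCoords fun i => affineLift t (affineCoords t x i)) F = 0 := by
  rw [rootPoint_eq_mk_affineLift hx]
  exact hF.eval_rep_mk_eq_zero_iff _

theorem continuous_rootPoint (n : ℕ) :
    Continuous fun x : (projectiveSpace 1).pow n => (show projectiveSpace n from rootPoint x) := by
  refine continuous_generateFrom_iff.2 ?_
  rintro _ ⟨d, F, hF, rfl⟩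
  refine isOpen_iff_eventually.2 fun x hx => ?_
  obtain ⟨t, ht⟩ := exists_mem_affineBox x
  obtain ⟨P, hP⟩ := exists_eval_rootCoords_affineLift n t F
  have hx : MvPolynomial.eval (rootPoint x).rep F ≠ 0 := hx
  rw [Ne, eval_rep_rootPoint_eq_zero_iff hF ht, hP] at hx
  filter_upwards [eventually_mem_affineBox ht,
    SpaceWithFunctions.ne_zero _ (regularAt_eval_affineCoords ht P) hx] with y h1 h2
  change MvPolynomial.eval (rootPoint y).rep F ≠ 0
  rw [Ne, eval_rep_rootPoint_eq_zero_iff hF h1, hP]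
  exact h2

theorem regularAt_comp_rootPoint {n : ℕ} {f : projectiveSpace n → ℂ} {x : (projectiveSpace 1).pow n}
    (hf : (projectiveSpace n).RegularAt f (rootPoint x)) :
    ((projectiveSpace 1).pow n).RegularAt (fun y => f (rootPoint y)) x := by
  obtain ⟨d, F, G, hF, hG, h0, he⟩ := hf
  obtain ⟨t, ht⟩ := exists_mem_affineBox x
  obtain ⟨P, hP⟩ := exists_eval_rootCoords_affineLift n t F
  obtain ⟨Q, hQ⟩ := exists_eval_rootCoords_affineLift n t G
  rw [Ne, eval_rep_rootPoint_eq_zero_iff hG ht, hQ] at h0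
  refine SpaceWithFunctions.congr _ ?_ (SpaceWithFunctions.mul _
    (regularAt_eval_affineCoords ht P) (SpaceWithFunctions.inv _
      (regularAt_eval_affineCoords ht Q) h0))
  filter_upwards [eventually_mem_affineBox ht,
    (continuous_rootPoint n).continuousAt.eventually he] with y h1 h2
  refine Eq.trans ?_ h2.symm
  rw [← div_eq_mul_inv, ← hP, ← hQ]
  change _ = MvPolynomial.eval (rootPoint y).rep F / MvPolynomial.eval (rootPoint y).rep G
  rw [rootPoint_eq_mk_affineLift h1]
  exact (hF.eval_rep_mk_div hG _).symm

/-! ### Openness of the root map and descent of regular functions -/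

open MvPolynomial in
theorem regularAt_sum_div_sum {n : ℕ} (c d : Fin (n + 1) → ℂ) {q : projectiveSpace n}
    (hq : ∑ j, q.rep j * d j ≠ 0) : (projectiveSpace n).RegularAt
      (fun q : ℙ ℂ (Fin (n + 1) → ℂ) => (∑ j, q.rep j * c j) / ∑ j, q.rep j * d j) q := by
  have h : ∀ c : Fin (n + 1) → ℂ,
      (∑ j, C (c j) * X j : MvPolynomial (Fin (n + 1)) ℂ).IsHomogeneous 1 := fun c =>
    IsHomogeneous.sum _ _ _ fun j _ => (isHomogeneous_X ℂ j).C_mul _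
  refine ⟨1, _, _, h c, h d, ?_, Filter.Eventually.of_forall fun q => ?_⟩
  · simpa [mul_comm] using hq
  · simp [mul_comm]

theorem affineForm_smul {n : ℕ} (t c : ℂ) (p : Fin (n + 1) → ℂ) :
    affineForm t (c • p) = Polynomial.C c * affineForm t p := by
  simp [affineForm, Finset.mul_sum, mul_assoc]

/-- A symmetric polynomial in the affine coordinates is a regular function of the root point. -/
theorem exists_regularAt_eq_eval_affineCoords {n : ℕ} (t : ℂ) {P : MvPolynomial (Fin n) ℂ}
    (hP : P.IsSymmetric) : ∃ s : projectiveSpace n → ℂ,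
      (∀ q : projectiveSpace n, binaryForm q.rep (-t) 1 ≠ 0 → (projectiveSpace n).RegularAt s q) ∧
        ∀ y ∈ affineBox n t, s (rootPoint y) = MvPolynomial.eval (affineCoords t y) P := by
  obtain ⟨Q, hQ⟩ := MvPolynomial.esymmAlgHom_fin_surjective (R := ℂ) (le_refl n) ⟨P, hP⟩
  have hQ := congrArg Subtype.val hQ
  rw [MvPolynomial.esymmAlgHom_apply] at hQ
  -- The variable `k` of `Q` stands for the elementary symmetric polynomial of degree `k + 1`, hence
  -- the coefficient index. Dividing by the top coefficient makes the expression independent of the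
  -- representative.
  refine ⟨fun q : ℙ ℂ (Fin (n + 1) → ℂ) => MvPolynomial.eval (fun k : Fin n =>
    (affineForm t q.rep).coeff (n - (k + 1)) / binaryForm q.rep (-t) 1) Q, fun q hq => ?_,
      fun y hy => ?_⟩
  · refine SpaceWithFunctions.regularAt_eval (fun k => ?_) Q
    simp only [affineForm, binaryForm, Polynomial.finsetSum_coeff, Polynomial.coeff_C_mul]
    exact regularAt_sum_div_sum _ _ hq
  · replace hQ : _ = P := hQ
    rw [← hQ, MvPolynomial.eval_aeval_eq]
    refine congrArg (fun g => MvPolynomial.eval g Q) (funext fun k => ?_)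
    rw [eval_esymm_eq_coeff_affineForm t _ k.2]
    obtain ⟨c, hc⟩ := Projectivization.exists_smul_eq_mk_rep ℂ
      (rootCoords fun i => affineLift t (affineCoords t y i))
      (rootCoords_ne_zero fun _ => affineLift_ne_zero _ _)
    rw [rootPoint_eq_mk_affineLift hy, ← hc, Units.smul_def, affineForm_smul, binaryForm_smul,
      binaryForm_rootCoords_affineLift_neg, Polynomial.coeff_C_mul,
      mul_div_mul_left _ _ c.ne_zero, div_one]

theorem eventually_binaryForm_rep_ne_zero {n : ℕ} {α β : ℂ} {q : projectiveSpace n}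
    (hq : binaryForm q.rep α β ≠ 0) :
    ∀ᶠ p : projectiveSpace n in 𝓝 q, binaryForm p.rep α β ≠ 0 := by
  have h : (∑ j : Fin (n + 1), MvPolynomial.X j * MvPolynomial.C (α ^ (j : ℕ) * β ^ (n - (j : ℕ))) :
      MvPolynomial (Fin (n + 1)) ℂ).IsHomogeneous 1 :=
    MvPolynomial.IsHomogeneous.sum _ _ _ fun j _ => by
      rw [mul_comm]
      exact (MvPolynomial.isHomogeneous_X ℂ j).C_mul _
  have h2 := eventually_eval_ne_zero h (p := q) (by simpa [binaryForm] using hq)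
  filter_upwards [h2] with p hp
  simpa [binaryForm] using (show _ ≠ (0 : ℂ) from hp)

theorem affineCoords_comp_perm {n : ℕ} (t : ℂ) (x : Fin n → ℙ ℂ (Fin 2 → ℂ))
    (σ : Equiv.Perm (Fin n)) : affineCoords t x ∘ σ = affineCoords t fun i => x (σ i) := rfl

theorem isOpenMap_rootPoint (n : ℕ) :
    IsOpenMap fun x : (projectiveSpace 1).pow n => (show projectiveSpace n from rootPoint x) := by
  refine IsOpenMap.of_nhds_le fun x S hS => ?_
  obtain ⟨t, ht⟩ := exists_mem_affineBox x
  obtain ⟨B, hB, hBS⟩ := polyNhds_le_nhds_pow ht (Filter.mem_map.1 hS)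
  obtain ⟨G, hG⟩ := exists_eval_sum_rename_mul_ne_zero hB
  obtain ⟨s, hs, hse⟩ := exists_regularAt_eq_eval_affineCoords t (isSymmetric_sum_rename (G * B))
  rw [← hse x ht] at hG
  have hx := mem_affineBox_iff.1 ht
  filter_upwards [eventually_binaryForm_rep_ne_zero hx,
    SpaceWithFunctions.ne_zero _ (hs _ hx) hG] with q h1 h2
  obtain ⟨y, rfl⟩ := rootPoint_surjective n q
  have hy := mem_affineBox_iff.2 h1
  rw [hse y hy, map_sum] at h2
  -- A nonzero symmetrization has a nonzero term, so some reordering of `y` lies where `B ≠ 0`,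
  -- hence over `S`; reordering does not change the root point.
  obtain ⟨σ, -, hσ⟩ := Finset.exists_ne_zero_of_sum_ne_zero h2
  rw [MvPolynomial.eval_rename, map_mul, affineCoords_comp_perm] at hσ
  have h3 : rootPoint (fun i => y (σ i)) ∈ S :=
    hBS (fun i => y (σ i)) (fun i => hy (σ i)) (right_ne_zero_of_mul hσ)
  rwa [rootPoint_comp_perm] at h3

theorem regularAt_rootPoint_iff {n : ℕ} {f : projectiveSpace n → ℂ}
    {x : (projectiveSpace 1).pow n} : (projectiveSpace n).RegularAt f (rootPoint x) ↔
      ((projectiveSpace 1).pow n).RegularAt (fun y => f (rootPoint y)) x := by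
  refine ⟨regularAt_comp_rootPoint, fun hf => ?_⟩
  obtain ⟨t, ht⟩ := exists_mem_affineBox x
  obtain ⟨A, B, hB, he⟩ := (isPolyFraction_of_regularAt_pow ht hf).exists_mul_eq
  obtain ⟨G, hG⟩ := exists_eval_sum_rename_mul_ne_zero hB
  obtain ⟨s, hs, hse⟩ := exists_regularAt_eq_eval_affineCoords t (isSymmetric_sum_rename (G * B))
  obtain ⟨r, hr, hre⟩ := exists_regularAt_eq_eval_affineCoords t (isSymmetric_sum_rename (G * A))
  rw [← hse x ht] at hG
  have hx := mem_affineBox_iff.1 ht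
  refine SpaceWithFunctions.congr _ ?_
    (SpaceWithFunctions.mul _ (hr _ hx) (SpaceWithFunctions.inv _ (hs _ hx) hG))
  filter_upwards [eventually_binaryForm_rep_ne_zero hx,
    SpaceWithFunctions.ne_zero _ (hs _ hx) hG] with q h1 h2
  obtain ⟨y, rfl⟩ := rootPoint_surjective n q
  have hy := mem_affineBox_iff.2 h1
  -- The pullback of `f` is invariant, so the relation `f B = A` holds with the same value of `f` at
  -- every reordering of `y`. Multiplying by `G` and summing shows that `f` is the quotient of the
  -- two symmetrizations.
  rw [← div_eq_mul_inv, div_eq_iff h2, hse y hy, hre y hy, map_sum, map_sum, Finset.mul_sum]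
  refine Finset.sum_congr rfl fun σ _ => ?_
  have h3 : f (rootPoint fun i => y (σ i)) * _ = _ := he (fun i => y (σ i)) fun i => hy (σ i)
  rw [rootPoint_comp_perm] at h3
  rw [MvPolynomial.eval_rename, MvPolynomial.eval_rename, map_mul, map_mul, affineCoords_comp_perm,
    ← h3]
  ring

/-! ### The isomorphism of varieties -/

/-- The isomorphism of the `n`-th symmetric product of the projective line with `ℂℙⁿ`. -/
noncomputable def symPowLineEquiv (n : ℕ) : (projectiveSpace 1).symPow n ≃ projectiveSpace n :=
  Equiv.ofBijective
    (Quotient.lift (s := (projectiveSpace 1).permSetoid n)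
      (fun x => (show projectiveSpace n from rootPoint x)) (by
        rintro x y ⟨σ, hσ⟩
        have : y = fun i => (show Fin n → ℙ ℂ (Fin 2 → ℂ) from x) (σ i) := funext hσ
        rw [this]
        exact (rootPoint_comp_perm _ σ).symm)) (by
    constructor
    · rintro ⟨x⟩ ⟨y⟩ h
      exact Quotient.sound (exists_perm_of_rootPoint_eq h)
    · intro q
      obtain ⟨x, hx⟩ := rootPoint_surjective n q
      exact ⟨Quotient.mk _ x, hx⟩)

theorem continuous_symPowLineEquiv (n : ℕ) : Continuous (symPowLineEquiv n) :=
  continuous_quot_lift _ (continuous_rootPoint n)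

theorem isOpenMap_symPowLineEquiv (n : ℕ) : IsOpenMap (symPowLineEquiv n) := by
  intro V hV
  have h := isOpenMap_rootPoint n _
    (hV.preimage (continuous_quotient_mk' (s := (projectiveSpace 1).permSetoid n)))
  convert h using 1
  ext q
  constructor
  · rintro ⟨⟨x⟩, hx, rfl⟩
    exact ⟨x, hx, rfl⟩
  · rintro ⟨x, hx, rfl⟩
    exact ⟨_, hx, rfl⟩

/-- The isomorphism of varieties of the `n`-th symmetric product of the projective line with
`ℂℙⁿ`. -/
noncomputable def symPowLineIso (n : ℕ) :
    SpaceWithFunctions.Iso ((projectiveSpace 1).symPow n) (projectiveSpace n) where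
  toHomeomorph := (symPowLineEquiv n).toHomeomorphOfContinuousOpen (continuous_symPowLineEquiv n)
    (isOpenMap_symPowLineEquiv n)
  regularAt_iff := by
    rintro g ⟨x⟩
    refine ⟨fun h => ?_, fun h => ?_⟩
    -- Regularity on a quotient is a condition at all points over a neighbourhood, so the regularity
    -- of `g` is first spread to nearby points.
    · have h1 := SpaceWithFunctions.eventually _ h
      refine ((continuous_symPowLineEquiv n).continuousAt.eventually h1).mono ?_
      rintro _ hp y rfl
      exact regularAt_rootPoint_iff.1 hp
    · exact regularAt_rootPoint_iff.2 (Filter.Eventually.self_of_nhds h x rfl)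

/-! ### Marked points and hyperplanes -/

theorem mul_sub_mul_eq_zero_iff_eq (x y : ℙ ℂ (Fin 2 → ℂ)) :
    y.rep 1 * x.rep 0 - y.rep 0 * x.rep 1 = 0 ↔ x = y := by
  refine ⟨fun h => ?_, fun h => by rw [h]; ring⟩
  by_contra hxy
  have hli := (Projectivization.linearIndependent_pair_iff_ne (D := x) (D' := y)).2 hxy
  rw [LinearIndependent.pair_iff] at hli
  -- In `y_0 x - x_0 y` one coordinate cancels identically and the other is the determinant up to
  -- sign; likewise with index `1`. Independence would then give `y_0 = y_1 = 0`.
  have h0 := hli (y.rep 0) (-x.rep 0) (by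
    ext j
    fin_cases j <;> simp <;> first | ring1 | linear_combination h | linear_combination -h)
  have h1 := hli (y.rep 1) (-x.rep 1) (by
    ext j
    fin_cases j <;> simp <;> first | ring1 | linear_combination h)
  exact y.rep_nonzero (funext fun j => by fin_cases j; exacts [h0.1, h1.1])

theorem rootPoint_mem_projectiveLocus_iff {n : ℕ} (x : Fin n → ℙ ℂ (Fin 2 → ℂ))
    (a : ℙ ℂ (Fin 2 → ℂ)) :
    rootPoint x ∈ projectiveLocus (rootHyperplane n a) ↔ ∃ i, x i = a := by
  change (rootPoint x).submodule ≤ _ ↔ _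
  rw [Projectivization.submodule_eq, Submodule.span_singleton_le_iff_mem, rootHyperplane,
    LinearMap.mem_ker, rootForm_apply, binaryForm_rep_rootPoint_eq_zero_iff]
  simp_rw [mul_sub_mul_eq_zero_iff_eq]

theorem symPowLineEquiv_image_sub (n : ℕ) {s : ℕ} (a : Fin s → ℙ ℂ (Fin 2 → ℂ)) :
    symPowLineEquiv n '' ((lineWithPoints a).symPow n).sub = (spaceWithHyperplanes n a).sub := by
  ext q
  obtain ⟨x, rfl⟩ := rootPoint_surjective n q
  refine Iff.trans ?_ (Set.mem_iUnion.trans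
    (exists_congr fun k => rootPoint_mem_projectiveLocus_iff x (a k))).symm
  constructor
  · rintro ⟨_, ⟨y, rfl, i, k, hk⟩, h⟩
    obtain ⟨σ, hσ⟩ := exists_perm_of_rootPoint_eq (h.symm : rootPoint x = rootPoint y)
    exact ⟨k, σ i, (hσ i).symm.trans hk.symm⟩
  · rintro ⟨k, i, hi⟩
    exact ⟨_, ⟨x, rfl, i, k, hi.symm⟩, rfl⟩

/-! ### General position -/

/-- Take the root coordinates of an `n`-tuple that contains every `b k` and avoids `a`; spare slots
are filled with some `c ≠ a`. -/
theorem exists_rootForm_ne_zero {n : ℕ} {ι : Type*} [Finite ι] (hι : Nat.card ι ≤ n)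
    (b : ι → ℙ ℂ (Fin 2 → ℂ)) (a : ℙ ℂ (Fin 2 → ℂ)) (ha : ∀ k, b k ≠ a) :
    ∃ p : Fin (n + 1) → ℂ, rootForm n a p ≠ 0 ∧ ∀ k, rootForm n (b k) p = 0 := by
  cases nonempty_fintype ι
  obtain ⟨g⟩ := Function.Embedding.nonempty_of_card_le (α := ι) (β := Fin n)
    (by simpa [Nat.card_eq_fintype_card] using hι)
  obtain ⟨c, hc⟩ : ∃ c : ℙ ℂ (Fin 2 → ℂ), c ≠ a := by
    by_contra! h
    have h1 : Projectivization.mk ℂ ![(1 : ℂ), 0] (by simp) =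
        Projectivization.mk ℂ ![(0 : ℂ), 1] (by simp) := (h _).trans (h _).symm
    obtain ⟨c, hc⟩ := (Projectivization.mk_eq_mk_iff' ℂ _ _ _ _).1 h1
    simpa using congrFun hc 0
  refine ⟨rootCoords fun j => (Function.extend g b (fun _ => c) j).rep, ?_, fun k => ?_⟩
  · rw [rootForm_apply, binaryForm_rootCoords, Finset.prod_ne_zero_iff]
    intro j _
    rw [Ne, mul_sub_mul_eq_zero_iff_eq]
    by_cases hj : ∃ k, g k = j
    · obtain ⟨k, rfl⟩ := hj
      rw [g.injective.extend_apply]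
      exact ha k
    · rwa [Function.extend_apply' _ _ _ hj]
  · rw [rootForm_apply, binaryForm_rootCoords]
    refine Finset.prod_eq_zero (Finset.mem_univ (g k)) ?_
    rw [mul_sub_mul_eq_zero_iff_eq, g.injective.extend_apply]

theorem inGeneralPosition_rootHyperplane (n : ℕ) {s : ℕ} {a : Fin s → ℙ ℂ (Fin 2 → ℂ)}
    (ha : Function.Injective a) : InGeneralPosition fun i => rootHyperplane n (a i) := by
  classical
  intro I hI
  rw [Module.finrank_fin_fun] at hI
  let T : (Fin (n + 1) → ℂ) →ₗ[ℂ] (I → ℂ) := LinearMap.pi fun i => rootForm n (a i)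
  have hker : (⨅ i ∈ I, rootHyperplane n (a i)) = LinearMap.ker T := by
    rw [LinearMap.ker_pi, iInf_subtype]
    rfl
  -- By rank-nullity, codimension `|I|` of the kernel amounts to surjectivity. Each basis vector is
  -- hit by interpolating at the points of `I`: removing one of at most `n + 1` points leaves at
  -- most `n`.
  have hsurj : LinearMap.range T = ⊤ := by
    rw [eq_top_iff, ← (Pi.basisFun ℂ I).span_eq, Submodule.span_le]
    rintro _ ⟨i, rfl⟩
    obtain ⟨p, hp, hk⟩ := exists_rootForm_ne_zero (n := n) (ι := {k : I // k ≠ i})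
      (by simp [Nat.card_eq_fintype_card, Fintype.card_subtype_compl]; omega)
      (fun k => a k) (a i) (fun k h => k.2 (Subtype.ext (ha h)))
    refine ⟨(rootForm n (a i) p)⁻¹ • p, funext fun k => ?_⟩
    by_cases h : k = i
    · subst h
      simp [T, hp]
    · simp [T, hk ⟨k, h⟩, h]
  have h := T.finrank_range_add_finrank_ker
  rw [hsurj, finrank_top, Module.finrank_fintype_fun_eq_card, Fintype.card_coe] at h
  rw [hker, ← h, add_comm]

/-- Changing the representative of `a` by `c ≠ 0` multiplies the equation by `c ^ n`. -/
theorem mem_rootHyperplane_iff {n : ℕ} {a : ℙ ℂ (Fin 2 → ℂ)} {α β : ℂ} (h : ![α, β] ≠ 0)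
    (ha : a = Projectivization.mk ℂ ![α, β] h) (p : Fin (n + 1) → ℂ) :
    p ∈ rootHyperplane n a ↔
      ∑ j : Fin (n + 1), p j * (α ^ (j : ℕ) * β ^ (n - (j : ℕ))) = 0 := by
  obtain ⟨c, hc⟩ := Projectivization.exists_smul_eq_mk_rep ℂ ![α, β] h
  rw [← ha] at hc
  rw [rootHyperplane, LinearMap.mem_ker, rootForm_apply, ← hc]
  have := binaryForm_mul_mul p c α β
  simp only [Units.smul_def, Pi.smul_apply, Matrix.cons_val_zero, Matrix.cons_val_one, smul_eq_mul,
    this, mul_eq_zero, pow_eq_zero_iff', c.ne_zero, false_and, false_or]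
  rfl

theorem mainTheorem4 (n s : ℕ) (a : Fin s → ℙ ℂ (Fin 2 → ℂ)) (ha : Function.Injective a) :
    (∃ φ : ClosedPair.Iso ((lineWithPoints a).symPow n) (spaceWithHyperplanes n a),
      ∀ (w : Fin n → Fin 2 → ℂ) (hw : ∀ i, w i ≠ 0), ∃ hp : rootCoords w ≠ 0,
        φ.toHomeomorph
            ((projectiveSpace 1).symPowMk fun i => Projectivization.mk ℂ (w i) (hw i)) =
          Projectivization.mk ℂ (rootCoords w) hp) ∧
    (∀ (i : Fin s) (α β : ℂ) (h : ![α, β] ≠ 0), a i = Projectivization.mk ℂ ![α, β] h →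
      ∀ p : Fin (n + 1) → ℂ, p ∈ rootHyperplane n (a i) ↔
        ∑ j : Fin (n + 1), p j * (α ^ (j : ℕ) * β ^ (n - (j : ℕ))) = 0) ∧
    (∀ (i : Fin s) (x : ℂ) (h : ![x, 1] ≠ 0), a i = Projectivization.mk ℂ ![x, 1] h →
      ∀ p : Fin (n + 1) → ℂ, p ∈ rootHyperplane n (a i) ↔
        ∑ j : Fin (n + 1), p j * x ^ (j : ℕ) = 0) ∧
    InGeneralPosition (fun i => rootHyperplane n (a i)) := by
  refine ⟨⟨⟨symPowLineIso n, symPowLineEquiv_image_sub n a⟩, fun w hw =>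
    ⟨rootCoords_ne_zero hw, rootPoint_mk hw⟩⟩, fun i α β h hi p => mem_rootHyperplane_iff h hi p,
    fun i x h hi p => ?_, inGeneralPosition_rootHyperplane n ha⟩
  rw [mem_rootHyperplane_iff h hi p]
  simp
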